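/- Let $\mathbb K$ be a field of characteristic $0$, let $\mathcal S\subset\mathbb Z$ be a finite set with $\max\mathcal S=a\ge 1$ and $\min\mathcal S=-b$, and let $(\omega_s)_{s\in\mathcal S}$ be weights in $\mathbb K$ with $\omega_a\neq 0$. An excursion of length $n$ is a sequence $(s_1,\dots,s_n)\in\mathcal S^n$ all of whose partial sums are non-negative and whose total sum is $0$; put $$E=\sum_{(s_1,\dots,s_n)\ \text{excursion}}\omega_{s_1}\cdots\omega_{s_n}\,t^n\in\mathbb K[[t]].$$ Let $K(u)=u^b\bigl(1-t\sum_{s\in\mathcal S}\omega_su^s\bigr)\in\mathbb K[t][u]$. Call a root of $K(u)$, taken in the Puiseux series in $t$ over an algebraic closure of $\mathbb K$, small if it is finite at $t=0$ (it has no negative exponent) and large otherwise. Suppose $\mathcal S=-\mathcal S$ and $\omega_s=\omega_{-s}$ for all $s\in\mathcal S$. Then $a=b$; $K(u)$ has, with multiplicity, $2a$ roots, all of which are Puiseux series with exponents in $\frac1a\mathbb Z$: $a$ small roots $U_1,\dots,U_a$ and $a$ large roots. The large roots are the inverses $1/U_1,\dots,1/U_a$ of the small roots. Write $U_{a+i}=1/U_i$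 and let $$Q(z)=\prod_{I\subset\{1,\dots,2a\},\,|I|=a}\Bigl(1-z\prod_{i\in I}U_i\Bigr),\qquad \bar Q(z)=\prod_{\varepsilon\in\{\pm1\}^a}\bigl(1-zU^{\varepsilon}\bigr),\quad U^\varepsilon=U_1^{\varepsilon_1}\cdots U_a^{\varepsilon_a}.$$ Then $Q$ and $\bar Q$ are polynomials in $z$ with coefficients in $\mathbb K(t)$, $\bar Q(z)$ divides $Q(z)$ in $\mathbb K(t)[z]$, and $\bar Q$ vanishes at $(-1)^{a+1}t\,\omega_a E$. Moreover, $D(t,z)=Q\bigl((-1)^{a+1}t\omega_az\bigr)$ and $\bar D(t,z)=\bar Q\bigl((-1)^{a+1}t\omega_az\bigr)$ belong to $\mathbb K[t,z]$, $\bar D$ divides $D$ in $\mathbb K[t,z]$, $\bar D$ has degree $2^a$ in $z$, and $\bar D(t,E)=0$. Hence $E$ is algebraic over $\mathbb K(t)$, of degree at most $2^a$. -/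

import Mathlib

open Polynomial
open scoped RatFunc

noncomputable section

namespace Excursions

/-- A sequence of steps is an excursion if all its partial sums are non-negative and its total
sum is `0`. The empty sequence is an excursion. -/
def IsExcursion {n : ℕ} (s : Fin n → ℤ) : Prop :=
  (∀ i : Fin n, 0 ≤ ∑ j ∈ Finset.Iic i, s j) ∧ ∑ j, s j = 0

open Classical in
/-- The finite set of excursions of length `n` with steps in `S`. -/
def excursions (S : Finset ℤ) (n : ℕ) : Finset (Fin n → ℤ) :=
  (Fintype.piFinset fun _ : Fin n => S).filter IsExcursion

variable {K : Type*} [Field K]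

/-- The excursion generating function `E`, a power series in `t`; the step `s` has weight `ω s`
and `t` marks the length. -/
def excursionSeries (S : Finset ℤ) (ω : ℤ → K) : PowerSeries K :=
  PowerSeries.mk fun n => ∑ s ∈ excursions S n, ∏ i, ω (s i)

/-- The kernel `K(u) = u ^ b * (1 - t * P(u))`, where `P(u) = ∑ s ∈ S, ω s * u ^ s` and
`- b = min S`. It is a polynomial in `u` (outer variable) whose coefficients are polynomials
in `t` (inner variable). As `b + s ≥ 0` for `s ∈ S`, the exponents are not truncated. -/
def kernel (S : Finset ℤ) (ω : ℤ → K) (b : ℕ) : K[X][X] :=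
  X ^ b - C X * ∑ s ∈ S, C (C (ω s)) * X ^ ((b : ℤ) + s).toNat

variable (K) in
/-- Series in `t` with rational exponents (with well-ordered support) and coefficients in an
algebraic closure of `K`. This field contains all Puiseux series in `t`; those are the series
whose exponents have a common denominator and are bounded below. -/
abbrev FracSeries : Type _ := HahnSeries ℚ (AlgebraicClosure K)

variable (K) in
/-- The embedding of `K[t]` into the series with rational exponents. -/
def polyToSeries : K[X] →+* FracSeries K :=
  ((HahnSeries.ofPowerSeries ℚ (AlgebraicClosure K)).comp
    (PowerSeries.map (algebraMap K (AlgebraicClosure K)))).comp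
      Polynomial.coeToPowerSeries.ringHom

theorem polyToSeries_injective : Function.Injective (polyToSeries K) := by
  intro p q h
  have h1 := HahnSeries.ofPowerSeries_injective (Γ := ℚ) (R := AlgebraicClosure K) h
  have h2 := PowerSeries.map_injective _ (algebraMap K (AlgebraicClosure K)).injective h1
  exact Polynomial.coe_injective K h2

variable (K) in
/-- The embedding of `K(t)` into the series with rational exponents. -/
def ratToSeries : RatFunc K →+* FracSeries K :=
  IsFractionRing.lift (polyToSeries_injective (K := K))

/-- The roots of the kernel, with multiplicity. -/
def kernelRoots (S : Finset ℤ) (ω : ℤ → K) (b : ℕ) : Multiset (FracSeries K) :=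
  ((kernel S ω b).map (polyToSeries K)).roots

open Classical in
/-- The small roots: those that are finite at `t = 0`, that is, without negative exponents. -/
def smallRoots (S : Finset ℤ) (ω : ℤ → K) (b : ℕ) : Multiset (FracSeries K) :=
  (kernelRoots S ω b).filter fun U => 0 ≤ U.orderTop

open Classical in
/-- The large roots: those that are infinite at `t = 0`. -/
def largeRoots (S : Finset ℤ) (ω : ℤ → K) (b : ℕ) : Multiset (FracSeries K) :=
  (kernelRoots S ω b).filter fun U => U.orderTop < 0

/-- `Q(z) = ∏_{|I| = a} (1 - z * U_I)`, over the `a`-element sub-families of a finite family `R`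
of series, `U_I` being the product of the sub-family. -/
def bigQ {L : Type*} [CommRing L] (R : Multiset L) (a : ℕ) : L[X] :=
  ((R.powersetCard a).map fun I => 1 - X * C I.prod).prod

/-- `∏_{ε ∈ {±1}^a} (1 - z * U ^ ε)`, where `U ^ ε = ∏ i, U i ^ ε i`. -/
def barQ {L : Type*} [Field L] {a : ℕ} (U : Fin a → L) : L[X] :=
  ∏ ε : Fin a → ℤˣ, (1 - X * C (∏ i, U i ^ (ε i : ℤ)))

/-- The normalising factor `(-1) ^ (a + 1) * t * ω_a`, an element of `K[t]`. -/
def scale (ω : ℤ → K) (a : ℕ) : K[X] := (-1) ^ (a + 1) * X * C (ω a)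

end Excursions

end

/-! The symmetry makes the kernel equation `1 = t * P(u)` invariant under `u ↦ 1/u`. Put `τ = t ^
(1/a)` and `u = w / τ`: the equation becomes polynomial in `τ` and `w`, and at `τ = 0` its nonzero
solutions satisfy `ω_a * w ^ a = 1`. These are `a` simple roots, which Hensel's lemma lifts
(`exists_powerSeries_root`). The series `τ / w` and `w / τ` are then `2a` distinct roots of orders
`1/a` and `-1/a`; since the kernel has degree at most `2a`, there are no others (`kernelRoots_eq`).

The kernel method identifies the product of the small roots. Adding a step to a non-negative walk
and discarding the walks that become negative is division by `u ^ b`. Telescoping these divisions at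
a small root shows that it is a zero of a monic polynomial of degree `b` with coefficients in
`K[[t]]`, whose constant term is `-t * ω_{-b} * E`. Vieta gives `∏ U i = (-1) ^ (b + 1) * t * ω_{-b}
* E` (`prod_small_roots`), and `barQ` vanishes there because of its factor with all signs `-1`.

Coefficients descend to `K(t)` by Galois theory: an automorphism permutes the roots and commutes
with inversion, so it acts by a signed permutation of the `U i`, which only reorders the factors of
`barQ` (`barQ_galois`). After rescaling `z`, the coefficients lie in `K[t]` by integrality together
with a valuation bound (`exists_map_eq_comp_of_integral`), and Gauss's lemma transfers divisibility
to `K[t, z]`. -/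

noncomputable section

namespace Excursions

/-! ### Hensel lifting of the rescaled kernel roots -/

section Hensel

variable {F : Type*} [Field F]

/-- Here `X` stands for `t ^ (1/a)`, and `w / X` will be a large root. Modulo `X` only the terms `s
= a` and `w ^ a` survive, and `c` is a simple root of what remains because the characteristic is
zero. -/
theorem exists_powerSeries_root [CharZero F] (S : Finset ℤ) (ω : ℤ → F) {a : ℕ}
    (ha : IsGreatest (S : Set ℤ) (a : ℤ)) (hb : ∀ s ∈ S, -(a : ℤ) ≤ s) (ha_pos : 0 < a)
    (hωa : ω a ≠ 0) {c : F} (hc : ω a * c ^ a = 1) :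
    ∃ w : PowerSeries F, PowerSeries.constantCoeff w = c ∧
      w ^ a = ∑ s ∈ S, PowerSeries.C (ω s) * PowerSeries.X ^ ((a : ℤ) - s).toNat *
        w ^ ((a : ℤ) + s).toNat := by
  classical
  -- The factor `(ω a)⁻¹` makes the polynomial monic, as Hensel's lemma requires; the leading term
  -- comes from `s = a`.
  set g : (PowerSeries F)[X] :=
    C (PowerSeries.C (ω a)⁻¹) * (∑ s ∈ S, C (PowerSeries.C (ω s) *
      PowerSeries.X ^ ((a : ℤ) - s).toNat) * X ^ ((a : ℤ) + s).toNat - X ^ a) with hg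
  have hmonic : g.Monic := by
    have h1 : g = X ^ (2 * a) + C (PowerSeries.C (ω a)⁻¹) * (∑ s ∈ S.erase (a : ℤ),
        C (PowerSeries.C (ω s) * PowerSeries.X ^ ((a : ℤ) - s).toNat) *
          X ^ ((a : ℤ) + s).toNat - X ^ a) := by
      rw [hg, ← Finset.add_sum_erase S _ ha.1]
      have e1 : ((a : ℤ) + a).toNat = 2 * a := by omega
      have e2 : (C (PowerSeries.C (ω a)⁻¹) * C (PowerSeries.C (ω a)) : (PowerSeries F)[X]) = 1 := by
        rw [← C_mul, ← map_mul, inv_mul_cancel₀ hωa, map_one, map_one]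
      simp only [sub_self, Int.toNat_zero, pow_zero, mul_one, e1]
      linear_combination X ^ (2 * a) * e2
    rw [h1]
    rw [C_mul']
    refine monic_X_pow_add ((degree_smul_le _ _).trans_lt ?_)
    refine (degree_sub_le _ _).trans_lt (max_lt ?_ ?_)
    · refine (degree_sum_le _ _).trans_lt ?_
      rw [Finset.sup_lt_iff (WithBot.bot_lt_coe _)]
      intro s hs
      refine (degree_C_mul_X_pow_le _ _).trans_lt ?_
      have h2 := ha.2 (Finset.mem_of_mem_erase hs)
      have h3 := Finset.ne_of_mem_erase hs
      exact_mod_cast (by omega : ((a : ℤ) + s).toNat < 2 * a)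
    · rw [degree_X_pow]
      exact_mod_cast (by omega : a < 2 * a)
  have hmap : g.map PowerSeries.constantCoeff = X ^ (2 * a) - C (ω a)⁻¹ * X ^ a := by
    rw [hg, Polynomial.map_mul, Polynomial.map_sub, Polynomial.map_sum,
      Finset.sum_eq_single (a : ℤ)]
    · have e1 : ((a : ℤ) + a).toNat = 2 * a := by omega
      have e2 : (C (ω a)⁻¹ * C (ω a) : F[X]) = 1 := by
        rw [← C_mul, inv_mul_cancel₀ hωa, map_one]
      simp [e1]
      linear_combination X ^ (2 * a) * e2
    · intro s hs hsa
      have h2 := ha.2 hs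
      have : ((a : ℤ) - s).toNat ≠ 0 := by omega
      simp [this]
    · intro h; exact absurd ha.1 h
  have hca : c ^ a = (ω a)⁻¹ := eq_inv_of_mul_eq_one_right hc
  have hc0 : c ≠ 0 := by
    rintro rfl
    rw [zero_pow ha_pos.ne', mul_zero] at hc
    exact zero_ne_one hc
  have heval : ∀ q : (PowerSeries F)[X], PowerSeries.constantCoeff (q.eval (PowerSeries.C c))
      = (q.map PowerSeries.constantCoeff).eval c := by
    intro q
    rw [eval_map, ← eval₂_hom, PowerSeries.constantCoeff_C]
  obtain ⟨w, hw, hwc⟩ := HenselianRing.is_henselian (I := Ideal.span {(PowerSeries.X : PowerSeries F)}) g hmonic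
    (PowerSeries.C c) (by
      rw [Ideal.mem_span_singleton, PowerSeries.X_dvd_iff, heval, hmap]
      simp [two_mul, pow_add, hca]) (by
      refine IsUnit.map _ ?_
      rw [PowerSeries.isUnit_iff_constantCoeff, heval, ← derivative_map, hmap]
      -- Multiplying the derivative by `c` turns all powers of `c` into powers of `c ^ a = (ω a)⁻¹`.
      have : (derivative (X ^ (2 * a) - C (ω a)⁻¹ * X ^ a : F[X])).eval c * c = a * (ω a)⁻¹ ^ 2 := by
        obtain ⟨k, rfl⟩ : ∃ k, a = k + 1 := ⟨a - 1, by omega⟩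
        rw [← hca]
        have e1 : 2 * (k + 1) - 1 = 2 * k + 1 := by omega
        simp only [derivative_sub, derivative_X_pow, derivative_C_mul, e1, eval_sub, eval_mul,
          eval_C, eval_pow, eval_X, Nat.add_sub_cancel]
        push_cast
        ring
      refine IsUnit.mk0 _ fun h => ?_
      rw [h, zero_mul] at this
      exact mul_ne_zero (Nat.cast_ne_zero.2 ha_pos.ne') (pow_ne_zero 2 (inv_ne_zero hωa)) this.symm)
  refine ⟨w, ?_, ?_⟩
  · rw [Ideal.mem_span_singleton, PowerSeries.X_dvd_iff, map_sub, sub_eq_zero] at hwc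
    simpa using hwc
  · have e2 : (PowerSeries.C (ω a)⁻¹ : PowerSeries F) ≠ 0 := by simpa using hωa
    rw [IsRoot, hg, eval_mul, eval_C, mul_eq_zero, or_iff_right e2, eval_sub, sub_eq_zero] at hw
    simpa [eval_finsetSum] using hw.symm

theorem exists_injective_pow_eq [CharZero F] [IsAlgClosed F] {a : ℕ} (ha_pos : 0 < a) {x : F}
    (hx : x ≠ 0) : ∃ c : Fin a → F, Function.Injective c ∧ ∀ i, x * c i ^ a = 1 := by
  classical
  have hs : (X ^ a - C x⁻¹ : F[X]).Separable :=
    separable_X_pow_sub_C _ (Nat.cast_ne_zero.2 ha_pos.ne') (inv_ne_zero hx)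
  have hcard : ((X ^ a - C x⁻¹ : F[X]).roots.toFinset).card = a := by
    rw [Multiset.toFinset_card_of_nodup (nodup_roots hs),
      ← (IsAlgClosed.splits _).natDegree_eq_card_roots, natDegree_X_pow_sub_C]
  let e := Finset.equivFinOfCardEq hcard
  refine ⟨fun i => (e.symm i : F), Subtype.val_injective.comp e.symm.injective, fun i => ?_⟩
  have := (e.symm i).2
  rw [Multiset.mem_toFinset, mem_roots', IsRoot] at this
  have h2 := this.2
  simp only [eval_sub, eval_pow, eval_X, eval_C, sub_eq_zero] at h2
  rw [h2, mul_inv_cancel₀ hx]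

end Hensel

/-! ### Substituting a fractional power of `t` -/

section Ramify

variable {F : Type*} [Field F]

theorem mulRight_inv_injective {a : ℕ} (ha : 0 < a) :
    Function.Injective (AddMonoidHom.mulRight ((a : ℚ)⁻¹)) :=
  mul_left_injective₀ (inv_ne_zero (Nat.cast_ne_zero.2 ha.ne'))

theorem mulRight_inv_le_iff {a : ℕ} (ha : 0 < a) (x y : ℚ) :
    AddMonoidHom.mulRight ((a : ℚ)⁻¹) x ≤ AddMonoidHom.mulRight ((a : ℚ)⁻¹) y ↔ x ≤ y :=
  mul_le_mul_iff_left₀ (inv_pos.2 (Nat.cast_pos.2 ha))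

variable (F) in
/-- The substitution `X ↦ t ^ (1 / a)`, from power series to series with rational exponents. -/
def ramify {a : ℕ} (ha : 0 < a) : PowerSeries F →+* HahnSeries ℚ F :=
  (HahnSeries.embDomainRingHom (AddMonoidHom.mulRight ((a : ℚ)⁻¹))
    (mulRight_inv_injective ha) (mulRight_inv_le_iff ha)).comp
    (HahnSeries.ofPowerSeries ℚ F)

variable {a : ℕ} (ha : 0 < a)

theorem ramify_injective : Function.Injective (ramify F ha) :=
  HahnSeries.embDomain_injective.comp HahnSeries.ofPowerSeries_injective

@[simp]
theorem ramify_C (c : F) : ramify F ha (PowerSeries.C c) = HahnSeries.C c := by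
  rw [ramify, RingHom.comp_apply, HahnSeries.ofPowerSeries_C, HahnSeries.embDomainRingHom_C]

@[simp]
theorem ramify_X : ramify F ha PowerSeries.X = HahnSeries.single (a : ℚ)⁻¹ 1 := by
  rw [ramify, RingHom.comp_apply, HahnSeries.ofPowerSeries_X,
    HahnSeries.embDomainRingHom_apply, HahnSeries.embDomain_single]
  simp

theorem support_ramify (f : PowerSeries F) :
    (ramify F ha f).support ⊆ {q | ∃ n : ℕ, q = (n : ℚ) / a} := by
  intro q hq
  obtain ⟨r, hr, rfl⟩ := HahnSeries.support_embDomain_subset hq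
  obtain ⟨n, -, rfl⟩ := HahnSeries.support_embDomain_subset hr
  exact ⟨n, rfl⟩

theorem orderTop_nonneg_of_support {x : HahnSeries ℚ F} (h : ∀ q ∈ x.support, 0 ≤ q) :
    0 ≤ x.orderTop := by
  rw [HahnSeries.le_orderTop_iff_forall]
  intro j hj
  by_contra hne
  exact absurd (h j hne) (not_le.2 (by exact_mod_cast hj))

theorem orderTop_ramify_nonneg (f : PowerSeries F) : 0 ≤ (ramify F ha f).orderTop := by
  refine orderTop_nonneg_of_support fun q hq => ?_
  obtain ⟨n, rfl⟩ := support_ramify ha f hq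
  positivity

/-- The series is a unit: its order and that of its inverse are both non-negative and add up to `0`.
-/
theorem orderTop_ramify {f : PowerSeries F} (hf : PowerSeries.constantCoeff f ≠ 0) :
    (ramify F ha f).orderTop = 0 := by
  refine le_antisymm ?_ (orderTop_ramify_nonneg ha f)
  have h1 : (ramify F ha f).orderTop + (ramify F ha f⁻¹).orderTop = 0 := by
    rw [← HahnSeries.orderTop_mul, ← map_mul, PowerSeries.mul_inv_cancel f hf, map_one,
      HahnSeries.orderTop_one]
  exact h1 ▸ le_add_of_nonneg_right (orderTop_ramify_nonneg ha f⁻¹)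

theorem support_single_mul_ramify (k : ℤ) (f : PowerSeries F) :
    ∀ q ∈ (HahnSeries.single (k / a : ℚ) 1 * ramify F ha f).support, ∃ m : ℤ, q = (m : ℚ) / a := by
  intro q hq
  obtain ⟨x, hx, y, hy, rfl⟩ := HahnSeries.support_mul_subset hq
  obtain ⟨n, rfl⟩ := support_ramify ha f hy
  have := HahnSeries.support_single_subset hx
  rw [Set.mem_singleton_iff] at this
  subst this
  exact ⟨k + n, by push_cast; ring⟩

end Ramify

/-! ### The small and large roots of the kernel -/

section Roots

variable {K : Type*} [Field K]

@[simp]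
theorem polyToSeries_X : polyToSeries K X = HahnSeries.single 1 1 := by
  simp [polyToSeries]

@[simp]
theorem polyToSeries_C (c : K) :
    polyToSeries K (C c) = HahnSeries.C (algebraMap K (AlgebraicClosure K) c) := by
  simp [polyToSeries]

/-- The sum `P(V) = ∑ s ∈ S, ω s * V ^ s`. -/
def stepSum (S : Finset ℤ) (ω : ℤ → K) (V : FracSeries K) : FracSeries K :=
  ∑ s ∈ S, HahnSeries.C (algebraMap K (AlgebraicClosure K) (ω s)) * V ^ s

variable {S : Finset ℤ} {ω : ℤ → K}

theorem stepSum_inv (hS : ∀ s ∈ S, -s ∈ S) (hω : ∀ s ∈ S, ω (-s) = ω s) (V : FracSeries K) :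
    stepSum S ω V⁻¹ = stepSum S ω V := by
  refine Finset.sum_nbij' (fun s => -s) (fun s => -s) hS hS (by simp) (by simp) fun s hs => ?_
  rw [hω s hs, inv_zpow']

theorem eval_kernel {b : ℕ} (hb : ∀ s ∈ S, -(b : ℤ) ≤ s) {V : FracSeries K} (hV : V ≠ 0) :
    ((kernel S ω b).map (polyToSeries K)).eval V =
      V ^ b * (1 - HahnSeries.single 1 1 * stepSum S ω V) := by
  simp only [kernel, stepSum, Polynomial.map_sub, Polynomial.map_pow, map_X, Polynomial.map_mul,
    map_C, polyToSeries_X, Polynomial.map_sum, polyToSeries_C, eval_sub, eval_pow, eval_X,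
    eval_mul, eval_C, eval_finsetSum]
  rw [mul_sub, mul_one, mul_left_comm, Finset.mul_sum, Finset.mul_sum, Finset.mul_sum]
  refine congrArg (fun x => V ^ b - x) ?_
  refine Finset.sum_congr rfl fun s hs => ?_
  have h := hb s hs
  rw [mul_left_comm (V ^ b), ← zpow_natCast V b, ← zpow_add₀ hV, ← zpow_natCast,
    Int.toNat_of_nonneg (by omega)]

variable {a : ℕ}

theorem exists_small_roots [CharZero K] (ha : IsGreatest (S : Set ℤ) (a : ℤ)) (hb : ∀ s ∈ S, -(a : ℤ) ≤ s)
    (ha_pos : 0 < a) (hωa : ω a ≠ 0) (hS : ∀ s ∈ S, -s ∈ S) (hω : ∀ s ∈ S, ω (-s) = ω s) :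
    ∃ W : Fin a → FracSeries K, Function.Injective W ∧
      (∀ i, (W i).orderTop = ((a : ℚ)⁻¹ : ℚ)) ∧
      (∀ i, ∀ q ∈ (W i).support, ∃ m : ℤ, q = (m : ℚ) / a) ∧
      (∀ i, ∀ q ∈ (W i)⁻¹.support, ∃ m : ℤ, q = (m : ℚ) / a) ∧
      ∀ i, HahnSeries.single 1 1 * stepSum S ω (W i) = 1 := by
  have hx : algebraMap K (AlgebraicClosure K) (ω a) ≠ 0 := by simpa using hωa
  obtain ⟨c, hc, hcr⟩ := exists_injective_pow_eq ha_pos hx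
  choose w hwc hw using fun i => exists_powerSeries_root S
    (fun s => algebraMap K (AlgebraicClosure K) (ω s)) ha hb ha_pos hx (hcr i)
  have hc0 : ∀ i, c i ≠ 0 := by
    intro i h
    have := hcr i
    rw [h, zero_pow ha_pos.ne', mul_zero] at this
    exact zero_ne_one this
  have hw0 : ∀ i, PowerSeries.constantCoeff (w i) ≠ 0 := fun i => hwc i ▸ hc0 i
  have hinv : ∀ i, ramify _ ha_pos (w i)⁻¹ = (ramify _ ha_pos (w i))⁻¹ := fun i =>
    eq_inv_of_mul_eq_one_right (by rw [← map_mul, PowerSeries.mul_inv_cancel _ (hw0 i), map_one])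
  have hne : ∀ i, ramify _ ha_pos (w i) ≠ 0 := by
    intro i h
    rw [map_eq_zero_iff _ (ramify_injective ha_pos)] at h
    exact hw0 i (by rw [h, map_zero])
  set τ : FracSeries K := HahnSeries.single (a : ℚ)⁻¹ 1 with hτ
  have hτ0 : τ ≠ 0 := HahnSeries.single_ne_zero one_ne_zero
  have hτa : τ ^ a = HahnSeries.single 1 1 := by
    rw [hτ, HahnSeries.single_pow, one_pow, nsmul_eq_mul,
      mul_inv_cancel₀ (Nat.cast_ne_zero.2 ha_pos.ne')]
  have hτinv : τ⁻¹ = HahnSeries.single (-(a : ℚ)⁻¹) 1 := by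
    rw [hτ, HahnSeries.inv_single, inv_one]
  -- The small root is `τ / w`. Its leading coefficient is the inverse of `c i`, so distinct `c i`
  -- give distinct roots.
  refine ⟨fun i => τ * ramify _ ha_pos (w i)⁻¹, ?_, ?_, ?_, ?_, ?_⟩
  · intro i j hij
    have h1 := mul_left_cancel₀ hτ0 hij
    rw [hinv, hinv, inv_inj] at h1
    have h2 := ramify_injective ha_pos h1
    exact hc (by rw [← hwc, ← hwc, h2])
  · intro i
    have h0 : PowerSeries.constantCoeff (w i)⁻¹ ≠ 0 := by
      rw [PowerSeries.constantCoeff_inv]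
      exact inv_ne_zero (hw0 i)
    rw [HahnSeries.orderTop_mul, orderTop_ramify ha_pos h0, add_zero, hτ,
      HahnSeries.orderTop_single one_ne_zero]
  · intro i q hq
    refine support_single_mul_ramify ha_pos 1 (w i)⁻¹ q ?_
    rwa [Int.cast_one, one_div]
  · intro i q hq
    refine support_single_mul_ramify ha_pos (-1) (w i) q ?_
    dsimp only at hq
    rw [mul_inv, hinv, inv_inv, hτinv] at hq
    rwa [Int.cast_neg, Int.cast_one, neg_div, one_div]
  · intro i
    dsimp only
    -- By symmetry the equation may be checked at the inverse `w / τ`, where multiplication by `w ^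
    -- a` yields the Hensel equation.
    rw [← stepSum_inv hS hω, mul_inv, hinv, inv_inv, ← hτa, stepSum, Finset.mul_sum]
    set x := ramify _ ha_pos (w i)
    have hxa : x ^ a ≠ 0 := pow_ne_zero _ (hne i)
    refine mul_left_cancel₀ hxa ?_
    have h1 := congrArg (ramify _ ha_pos) (hw i)
    simp only [map_pow, map_sum, map_mul, ramify_C, ramify_X] at h1
    rw [mul_one, Finset.mul_sum]
    refine Eq.trans ?_ h1.symm
    refine Finset.sum_congr rfl fun s hs => ?_
    have h2 := hb s hs
    have h3 := ha.2 hs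
    have e1 : τ ^ ((a : ℤ) - s).toNat = τ ^ a * (τ⁻¹) ^ s := by
      rw [← zpow_natCast, Int.toNat_of_nonneg (by omega), zpow_sub₀ hτ0, zpow_natCast, inv_zpow,
        div_eq_mul_inv]
    have e2 : x ^ ((a : ℤ) + s).toNat = x ^ a * x ^ s := by
      rw [← zpow_natCast, Int.toNat_of_nonneg (by omega), zpow_add₀ (hne i), zpow_natCast]
    rw [← hτ, e1, e2, mul_zpow]
    ring

theorem natDegree_kernel_le (ha : ∀ s ∈ S, s ≤ a) :
    (kernel S ω a).natDegree ≤ 2 * a := by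
  refine (natDegree_sub_le _ _).trans (max_le ?_ ?_)
  · rw [natDegree_X_pow]; omega
  · refine (natDegree_C_mul_le _ _).trans (natDegree_sum_le_of_forall_le _ _ fun s hs => ?_)
    refine (natDegree_C_mul_X_pow_le _ _).trans ?_
    have := ha s hs
    omega

/-- The listed `2a` roots are pairwise distinct, orders `1/a` and `-1/a` separating the two halves,
and the degree bound leaves room for no others or for multiplicities. -/
theorem kernelRoots_eq (ha : ∀ s ∈ S, s ≤ a) (hb : ∀ s ∈ S, -(a : ℤ) ≤ s)
    (hker : kernel S ω a ≠ 0) (hS : ∀ s ∈ S, -s ∈ S) (hω : ∀ s ∈ S, ω (-s) = ω s)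
    {W : Fin a → FracSeries K} (hW : Function.Injective W)
    (hord : ∀ i, (W i).orderTop = ((a : ℚ)⁻¹ : ℚ))
    (hroot : ∀ i, HahnSeries.single 1 1 * stepSum S ω (W i) = 1) :
    kernelRoots S ω a = Finset.univ.val.map W + Finset.univ.val.map fun i => (W i)⁻¹ := by
  have hker' : (kernel S ω a).map (polyToSeries K) ≠ 0 :=
    (Polynomial.map_ne_zero_iff polyToSeries_injective).2 hker
  have h0 : ∀ i, W i ≠ 0 := fun i h => by
    have := hord i
    rw [h, HahnSeries.orderTop_zero] at this
    exact WithTop.top_ne_coe this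
  symm
  refine Multiset.eq_of_le_of_card_le ?_ ?_
  · rw [Multiset.le_iff_subset]
    · intro V hV
      rw [Multiset.mem_add, Multiset.mem_map, Multiset.mem_map] at hV
      rw [kernelRoots, mem_roots hker', IsRoot]
      rcases hV with ⟨i, -, rfl⟩ | ⟨i, -, rfl⟩
      · rw [eval_kernel hb (h0 i), hroot, sub_self, mul_zero]
      · rw [eval_kernel hb (inv_ne_zero (h0 i)), stepSum_inv hS hω, hroot, sub_self, mul_zero]
    · rw [Multiset.nodup_add]
      refine ⟨Finset.univ.nodup.map hW, Finset.univ.nodup.map (inv_injective.comp hW), ?_⟩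
      rw [Multiset.disjoint_left]
      intro V hV hV'
      rw [Multiset.mem_map] at hV hV'
      obtain ⟨i, -, rfl⟩ := hV
      obtain ⟨j, -, hij⟩ := hV'
      have ha_pos : 0 < a := i.pos
      have h1 : (W j * W i).orderTop = 0 := by
        rw [← hij, mul_inv_cancel₀ (h0 j), HahnSeries.orderTop_one]
      rw [HahnSeries.orderTop_mul, hord, hord] at h1
      have h2 : (a : ℚ)⁻¹ + (a : ℚ)⁻¹ = 0 := by exact_mod_cast h1
      have : (0 : ℚ) < (a : ℚ)⁻¹ := by positivity
      linarith
  · refine (card_roots' _).trans (natDegree_map_le.trans ((natDegree_kernel_le ha).trans ?_))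
    simp [two_mul]

theorem smallRoots_eq {b : ℕ} {W : Fin a → FracSeries K}
    (hord : ∀ i, (W i).orderTop = ((a : ℚ)⁻¹ : ℚ)) (hord' : ∀ i, (W i)⁻¹.orderTop < 0)
    (hroots : kernelRoots S ω b = Finset.univ.val.map W + Finset.univ.val.map fun i => (W i)⁻¹) :
    smallRoots S ω b = Finset.univ.val.map W ∧
      largeRoots S ω b = Finset.univ.val.map fun i => (W i)⁻¹ := by
  have hpos : ∀ i, 0 ≤ (W i).orderTop := fun i => by
    rw [hord]
    exact_mod_cast (by positivity : (0 : ℚ) ≤ (a : ℚ)⁻¹)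
  rw [smallRoots, largeRoots, hroots, Multiset.filter_add, Multiset.filter_add]
  constructor
  · rw [Multiset.filter_eq_self.2, Multiset.filter_eq_nil.2, add_zero]
    · simpa using hord'
    · simpa using hpos
  · rw [Multiset.filter_eq_nil.2, Multiset.filter_eq_self.2, zero_add]
    · simpa using hord'
    · simpa using hpos

theorem orderTop_inv_neg {W : FracSeries K} (hord : W.orderTop = ((a : ℚ)⁻¹ : ℚ)) :
    W⁻¹.orderTop = ((-(a : ℚ)⁻¹ : ℚ) : WithTop ℚ) := by
  have h0 : W ≠ 0 := fun h => by
    rw [h, HahnSeries.orderTop_zero] at hord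
    exact WithTop.top_ne_coe hord
  have h1 : (W * W⁻¹).orderTop = 0 := by
    rw [mul_inv_cancel₀ h0, HahnSeries.orderTop_one]
  rw [HahnSeries.orderTop_mul, hord] at h1
  obtain ⟨q, hq⟩ := WithTop.ne_top_iff_exists.1 (HahnSeries.orderTop_ne_top.2 (inv_ne_zero h0))
  rw [← hq] at h1 ⊢
  have h2 : (a : ℚ)⁻¹ + q = 0 := by exact_mod_cast h1
  exact_mod_cast (by linarith : q = -(a : ℚ)⁻¹)

end Roots

/-! ### Non-negative walks and the kernel method -/

section Meanders

variable {R : Type*} [CommRing R] (S : Finset ℤ) (ω : ℤ → R)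

open Classical in
/-- The total weight of the sequences of `n` steps with non-negative partial sums and total
sum `h`. -/
def meanderWeight (n : ℕ) (h : ℤ) : R :=
  ∑ s ∈ (Fintype.piFinset fun _ : Fin n => S).filter
    (fun s => (∀ i : Fin n, 0 ≤ ∑ j ∈ Finset.Iic i, s j) ∧ ∑ j, s j = h), ∏ i, ω (s i)

theorem meanderWeight_zero (h : ℤ) : meanderWeight S ω 0 h = if h = 0 then 1 else 0 := by
  classical
  rw [meanderWeight]
  split_ifs with hh
  · subst hh
    rw [Finset.filter_true_of_mem (by simp)]
    simp
  · rw [Finset.filter_false_of_mem (by simpa using Ne.symm hh)]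
    simp

theorem meanderWeight_of_neg (n : ℕ) {h : ℤ} (hh : h < 0) : meanderWeight S ω n h = 0 := by
  classical
  rw [meanderWeight, Finset.filter_false_of_mem, Finset.sum_empty]
  rintro s - ⟨h1, h2⟩
  cases n with
  | zero => simp at h2; omega
  | succ n =>
    have h3 := h1 (Fin.last n)
    rw [← Fin.top_eq_last, Finset.Iic_top, h2] at h3
    omega

/-- The last step is split off. The condition on the full partial sum is `0 ≤ h`, so only the
conditions on the shorter walk remain. -/
theorem meanderWeight_succ (n : ℕ) {h : ℤ} (hh : 0 ≤ h) :
    meanderWeight S ω (n + 1) h = ∑ s ∈ S, ω s * meanderWeight S ω n (h - s) := by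
  classical
  simp only [meanderWeight, Finset.mul_sum, Finset.sum_filter]
  rw [← Finset.sum_product']
  refine Finset.sum_nbij' (fun s => (s (Fin.last n), Fin.init s))
    (fun p => Fin.snoc (α := fun _ => ℤ) p.2 p.1) ?_ ?_ ?_ ?_ ?_
  · intro s hs
    rw [Fintype.mem_piFinset] at hs
    exact Finset.mem_product.2 ⟨hs _, Fintype.mem_piFinset.2 fun i => hs _⟩
  · intro p hp
    rw [Finset.mem_product, Fintype.mem_piFinset] at hp
    refine Fintype.mem_piFinset.2 fun i => ?_
    refine Fin.lastCases ?_ (fun j => ?_) i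
    · rw [Fin.snoc_last]; exact hp.1
    · rw [Fin.snoc_castSucc]; exact hp.2 j
  · intro s _
    exact Fin.snoc_init_self s
  · intro p _
    simp
  · intro s _
    have hiff : ((∀ i : Fin (n + 1), 0 ≤ ∑ j ∈ Finset.Iic i, s j) ∧ ∑ j, s j = h) ↔
        ((∀ i : Fin n, 0 ≤ ∑ j ∈ Finset.Iic i, Fin.init s j) ∧
          ∑ j, Fin.init s j = h - s (Fin.last n)) := by
      rw [Fin.forall_fin_succ', Fin.sum_univ_castSucc, ← Fin.top_eq_last, Finset.Iic_top,
        Fin.top_eq_last, Fin.sum_univ_castSucc]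
      simp only [Fin.sum_Iic_castSucc, Fin.init]
      constructor
      · rintro ⟨⟨h1, h2⟩, h3⟩
        exact ⟨h1, by omega⟩
      · rintro ⟨h1, h2⟩
        exact ⟨⟨h1, by omega⟩, by omega⟩
    simp only [hiff, mul_ite, mul_zero]
    refine if_congr Iff.rfl ?_ rfl
    rw [Fin.prod_univ_castSucc, mul_comm]
    rfl

/-- The polynomial `u ^ b * P(u)`, where `P(u) = ∑ s ∈ S, ω s * u ^ s`. -/
def stepPoly (b : ℕ) : R[X] := ∑ s ∈ S, C (ω s) * X ^ ((b : ℤ) + s).toNat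

/-- The generating polynomial of sequences of `n` steps with non-negative partial sums, by total
sum. -/
def meanderPoly (b : ℕ) : ℕ → R[X]
  | 0 => 1
  | n + 1 => (stepPoly S ω b * meanderPoly b n) /ₘ X ^ b

/-- The part of `u ^ b * P(u) * meanderPoly` that accounts for the steps to negative heights. -/
def meanderRem (b n : ℕ) : R[X] := (stepPoly S ω b * meanderPoly S ω b n) %ₘ X ^ b

variable {S ω} {b : ℕ}

theorem stepPoly_mul_meanderPoly (n : ℕ) :
    stepPoly S ω b * meanderPoly S ω b n =
      meanderRem S ω b n + X ^ b * meanderPoly S ω b (n + 1) :=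
  (modByMonic_add_div _ (X ^ b)).symm

theorem degree_meanderRem_lt [Nontrivial R] (n : ℕ) : (meanderRem S ω b n).degree < b := by
  have := degree_modByMonic_lt (stepPoly S ω b * meanderPoly S ω b n) (monic_X_pow (R := R) b)
  rwa [degree_X_pow] at this

theorem coeff_meanderPoly (hb : ∀ s ∈ S, -(b : ℤ) ≤ s) (n h : ℕ) :
    (meanderPoly S ω b n).coeff h = meanderWeight S ω n h := by
  nontriviality R
  induction n generalizing h with
  | zero => simp [meanderPoly, meanderWeight_zero, coeff_one]
  | succ n ih =>
    -- In degree `h + b` the remainder, of degree less than `b`, contributes nothing.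
    have h1 := congrArg (fun p => p.coeff (h + b)) (stepPoly_mul_meanderPoly (S := S) (ω := ω) (b := b) n)
    simp only [coeff_add, coeff_X_pow_mul] at h1
    rw [coeff_eq_zero_of_degree_lt ((degree_meanderRem_lt n).trans_le (by exact_mod_cast (by omega))),
      zero_add] at h1
    rw [← h1, meanderWeight_succ _ _ _ (by omega), stepPoly, Finset.sum_mul, finsetSum_coeff]
    refine Finset.sum_congr rfl fun s hs => ?_
    have h2 := hb s hs
    rw [mul_assoc, coeff_C_mul, coeff_X_pow_mul']
    congr 1
    split_ifs with h3
    · rw [ih]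
      congr 1
      omega
    · rw [meanderWeight_of_neg]
      omega

theorem stepPoly_coeff_zero (hmem : -(b : ℤ) ∈ S) (hb : ∀ s ∈ S, -(b : ℤ) ≤ s) :
    (stepPoly S ω b).coeff 0 = ω (-b) := by
  rw [stepPoly, finsetSum_coeff, Finset.sum_eq_single (-(b : ℤ))]
  · simp
  · intro s hs hne
    have := hb s hs
    rw [coeff_C_mul_X_pow, if_neg (by omega)]
  · intro h; exact absurd hmem h

/-- After the shift by `b`, exponent `0` is height `-b`, which is reached only by the step `-b` from
height `0`. This is where excursions enter. -/
theorem meanderRem_coeff_zero (hmem : -(b : ℤ) ∈ S) (hb : ∀ s ∈ S, -(b : ℤ) ≤ s) (hb0 : 0 < b)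
    (n : ℕ) : (meanderRem S ω b n).coeff 0 = ω (-b) * meanderWeight S ω n 0 := by
  have h1 := congrArg (fun p => p.coeff 0) (stepPoly_mul_meanderPoly (S := S) (ω := ω) (b := b) n)
  simp only [coeff_add, mul_coeff_zero, coeff_X_pow, if_neg hb0.ne, zero_mul, add_zero,
    stepPoly_coeff_zero hmem hb, coeff_meanderPoly hb] at h1
  exact h1.symm

/-- The kernel method, with a remainder of order `N`. -/
theorem pow_eq_sum_meanderRem {L : Type*} [CommRing L] (φ : R →+* L) {T U : L}
    (hU : T * (stepPoly S ω b).eval₂ φ U = U ^ b) (N : ℕ) :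
    U ^ b = ∑ n ∈ Finset.range N, T ^ (n + 1) * (meanderRem S ω b n).eval₂ φ U +
      T ^ N * (U ^ b * (meanderPoly S ω b N).eval₂ φ U) := by
  induction N with
  | zero => simp [meanderPoly]
  | succ N ih =>
    have h1 := congrArg (eval₂ φ U) (stepPoly_mul_meanderPoly (S := S) (ω := ω) (b := b) N)
    rw [eval₂_mul, eval₂_add, eval₂_mul, eval₂_X_pow] at h1
    rw [Finset.sum_range_succ]
    -- In the error term, `U ^ b` is replaced by means of the kernel equation; division by `U ^ b`
    -- then splits off one more remainder.
    linear_combination ih + T ^ (N + 1) * h1 - T ^ N * (meanderPoly S ω b N).eval₂ φ U * hU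

end Meanders

/-! ### Series without negative exponents and `t`-adic approximation -/

section Integers

variable (F : Type*) [Field F]

/-- The valuation ring of series without negative exponents. -/
def integerSeries : Subring (HahnSeries ℚ F) where
  carrier := {x | 0 ≤ x.orderTop}
  mul_mem' := fun {x y} hx hy => by
    rw [Set.mem_ofPred_eq] at hx hy ⊢
    rw [HahnSeries.orderTop_mul]
    exact add_nonneg hx hy
  one_mem' := by rw [Set.mem_ofPred_eq, HahnSeries.orderTop_one]
  add_mem' := fun {x y} hx hy => by
    rw [Set.mem_ofPred_eq] at hx hy ⊢
    exact (le_min hx hy).trans HahnSeries.min_orderTop_le_orderTop_add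
  zero_mem' := by simp
  neg_mem' := fun {x} hx => by rwa [Set.mem_ofPred_eq, HahnSeries.orderTop_neg]

variable {F}

theorem mem_integerSeries {x : HahnSeries ℚ F} : x ∈ integerSeries F ↔ 0 ≤ x.orderTop :=
  Set.mem_ofPred

theorem C_mem_integerSeries (c : F) : HahnSeries.C c ∈ integerSeries F :=
  mem_integerSeries.2 HahnSeries.orderTop_single_le

theorem ofPowerSeries_mem_integerSeries (f : PowerSeries F) :
    HahnSeries.ofPowerSeries ℚ F f ∈ integerSeries F := by
  refine mem_integerSeries.2 (orderTop_nonneg_of_support fun q hq => ?_)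
  obtain ⟨n, -, rfl⟩ := HahnSeries.support_embDomain_subset hq
  exact Nat.cast_nonneg n

/-- A nonzero series has a finite order, which some `N` exceeds. This replaces passing to the limit
in the kernel method. -/
theorem eq_zero_of_forall_dvd {x : HahnSeries ℚ F}
    (h : ∀ N : ℕ, ∃ y ∈ integerSeries F, x = HahnSeries.single 1 1 ^ N * y) : x = 0 := by
  by_contra hx
  obtain ⟨q, hq⟩ := WithTop.ne_top_iff_exists.1 (HahnSeries.orderTop_ne_top.2 hx)
  obtain ⟨N, hN⟩ := exists_nat_gt q
  obtain ⟨y, hy, hxy⟩ := h N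
  have h1 : ((N : ℚ) : WithTop ℚ) ≤ x.orderTop := by
    rw [hxy, HahnSeries.single_pow, HahnSeries.orderTop_mul, one_pow,
      HahnSeries.orderTop_single one_ne_zero, nsmul_eq_mul, mul_one]
    exact le_add_of_nonneg_right (mem_integerSeries.1 hy)
  rw [← hq, WithTop.coe_le_coe] at h1
  exact absurd hN (not_lt.2 h1)

theorem ofPowerSeries_eq_sum_add (f : PowerSeries F) (N : ℕ) :
    ∃ y ∈ integerSeries F, HahnSeries.ofPowerSeries ℚ F f =
      ∑ n ∈ Finset.range N, HahnSeries.single 1 1 ^ n * HahnSeries.C (PowerSeries.coeff n f) +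
        HahnSeries.single 1 1 ^ N * y := by
  refine ⟨_, ofPowerSeries_mem_integerSeries (PowerSeries.mk fun i => PowerSeries.coeff (i + N) f), ?_⟩
  conv_lhs => rw [PowerSeries.eq_X_pow_mul_shift_add_trunc N f]
  rw [map_add, map_mul, map_pow, HahnSeries.ofPowerSeries_X, add_comm]
  congr 1
  have h : ∀ p : F[X], HahnSeries.ofPowerSeries ℚ F p =
      p.eval₂ HahnSeries.C (HahnSeries.single 1 1) := by
    intro p
    refine RingHom.congr_fun (f := (HahnSeries.ofPowerSeries ℚ F).comp coeToPowerSeries.ringHom)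
      (g := eval₂RingHom HahnSeries.C (HahnSeries.single 1 1)) ?_ p
    refine Polynomial.ringHom_ext (fun c => ?_) ?_
    · simp
    · simp
  rw [h, PowerSeries.eval₂_trunc_eq_sum_range]
  exact Finset.sum_congr rfl fun n _ => mul_comm _ _

end Integers

/-! ### The product of the small roots -/

section Product

variable {K : Type*} [Field K]

/-- The inclusion of the constants. -/
def constToSeries : K →+* FracSeries K :=
  HahnSeries.C.comp (algebraMap K (AlgebraicClosure K))

variable (K) in
/-- The embedding of power series in `t` into the series with rational exponents. -/
def powerToSeries : PowerSeries K →+* FracSeries K :=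
  (HahnSeries.ofPowerSeries ℚ (AlgebraicClosure K)).comp
    (PowerSeries.map (algebraMap K (AlgebraicClosure K)))

theorem powerToSeries_injective : Function.Injective (powerToSeries K) :=
  fun _ _ h => PowerSeries.map_injective _ (algebraMap K (AlgebraicClosure K)).injective
    (HahnSeries.ofPowerSeries_injective (Γ := ℚ) (R := AlgebraicClosure K) h)

variable {S : Finset ℤ} {ω : ℤ → K} {b : ℕ}

theorem eval₂_stepPoly (hb : ∀ s ∈ S, -(b : ℤ) ≤ s) {V : FracSeries K} (hV : V ≠ 0) :
    (stepPoly S ω b).eval₂ constToSeries V = V ^ b * stepSum S ω V := by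
  rw [stepPoly, eval₂_finsetSum, stepSum, Finset.mul_sum]
  refine Finset.sum_congr rfl fun s hs => ?_
  have h := hb s hs
  rw [eval₂_mul, eval₂_C, eval₂_X_pow, mul_left_comm (V ^ b), ← zpow_natCast V b, ← zpow_add₀ hV,
    ← zpow_natCast, Int.toNat_of_nonneg (by omega)]
  rfl

variable (S ω b) in
/-- The generating function of the coefficient of `u ^ k` in the remainders. -/
def remSeries (k : ℕ) : PowerSeries K := PowerSeries.mk fun n => (meanderRem S ω b n).coeff k

variable (S ω b) in
/-- The polynomial `∏ (u - U i)` over the small roots, as given by the kernel method. -/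
def smallPoly : (FracSeries K)[X] :=
  X ^ b - ∑ k ∈ Finset.range b,
    C (HahnSeries.single 1 1 * powerToSeries K (remSeries S ω b k)) * X ^ k

theorem degree_smallPoly_tail_lt : Polynomial.degree (∑ k ∈ Finset.range b,
    C (HahnSeries.single 1 1 * powerToSeries K (remSeries S ω b k)) * X ^ k) < (b : WithBot ℕ) := by
  refine (degree_sum_le _ _).trans_lt ((Finset.sup_lt_iff (WithBot.bot_lt_coe b)).2 fun k hk => ?_)
  exact (degree_C_mul_X_pow_le _ _).trans_lt (WithBot.coe_lt_coe.2 (Finset.mem_range.1 hk))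

theorem smallPoly_monic : (smallPoly S ω b).Monic :=
  monic_X_pow_sub degree_smallPoly_tail_lt

theorem natDegree_smallPoly : (smallPoly S ω b).natDegree = b := by
  refine natDegree_eq_of_degree_eq_some ?_
  rw [smallPoly, degree_sub_eq_left_of_degree_lt, degree_X_pow]
  rw [degree_X_pow]
  exact degree_smallPoly_tail_lt

/-- The kernel identity with `N` remainders and the truncation of each `remSeries` at order `N`
agree up to a multiple of `t ^ N`, for every `N`. Smallness of `U` keeps the error factors free of
negative exponents. -/
theorem eval_smallPoly {U : FracSeries K} (hU0 : U ∈ integerSeries (AlgebraicClosure K))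
    (hU : HahnSeries.single 1 1 * (stepPoly S ω b).eval₂ constToSeries U = U ^ b) :
    (smallPoly S ω b).eval U = 0 := by
  refine eq_zero_of_forall_dvd fun N => ?_
  choose y hy hys using fun k => ofPowerSeries_eq_sum_add
    (PowerSeries.map (algebraMap K (AlgebraicClosure K)) (remSeries S ω b k)) N
  have hpow := pow_eq_sum_meanderRem constToSeries hU N
  have hmem : ∀ p : K[X], p.eval₂ constToSeries U ∈ integerSeries (AlgebraicClosure K) := by
    intro p
    rw [eval₂_eq_sum_range]
    exact Subring.sum_mem _ fun i _ => Subring.mul_mem _ (C_mem_integerSeries _)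
      (Subring.pow_mem _ hU0 _)
  -- The first term is the error of the kernel identity, the second that of truncating the
  -- coefficients; the extra `t` is the one in `smallPoly`.
  refine ⟨U ^ b * (meanderPoly S ω b N).eval₂ constToSeries U -
    HahnSeries.single 1 1 * ∑ k ∈ Finset.range b, y k * U ^ k, ?_, ?_⟩
  · refine Subring.sub_mem _ (Subring.mul_mem _ (Subring.pow_mem _ hU0 _) (hmem _))
      (Subring.mul_mem _ ?_ (Subring.sum_mem _ fun k _ =>
        Subring.mul_mem _ (hy k) (Subring.pow_mem _ hU0 _)))
    rw [mem_integerSeries, HahnSeries.orderTop_single one_ne_zero]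
    exact_mod_cast zero_le_one (α := ℚ)
  · have h1 : ∀ n, (meanderRem S ω b n).eval₂ constToSeries U =
        ∑ k ∈ Finset.range b, constToSeries ((meanderRem S ω b n).coeff k) * U ^ k := by
      intro n
      by_cases hp : meanderRem S ω b n = 0
      · simp [hp]
      · exact eval₂_eq_sum_range' _ ((natDegree_lt_iff_degree_lt hp).2 (degree_meanderRem_lt n)) U
    have h2 : ∑ k ∈ Finset.range b, powerToSeries K (remSeries S ω b k) * U ^ k =
        ∑ n ∈ Finset.range N, HahnSeries.single 1 1 ^ n *
          (meanderRem S ω b n).eval₂ constToSeries U +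
        HahnSeries.single 1 1 ^ N * ∑ k ∈ Finset.range b, y k * U ^ k := by
      simp only [h1, Finset.mul_sum]
      rw [Finset.sum_comm, ← Finset.sum_add_distrib]
      refine Finset.sum_congr rfl fun k _ => ?_
      rw [powerToSeries, RingHom.comp_apply, hys k, add_mul, Finset.sum_mul]
      simp only [remSeries, PowerSeries.coeff_map, PowerSeries.coeff_mk, constToSeries,
        RingHom.comp_apply, mul_assoc]
    rw [smallPoly, eval_sub, eval_X_pow, eval_finsetSum]
    simp only [eval_mul, eval_C, eval_X_pow, mul_assoc]
    have h3 : HahnSeries.single 1 1 * ∑ n ∈ Finset.range N, HahnSeries.single 1 1 ^ n *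
        (meanderRem S ω b n).eval₂ constToSeries U = ∑ n ∈ Finset.range N,
          HahnSeries.single 1 1 ^ (n + 1) * (meanderRem S ω b n).eval₂ constToSeries U := by
      rw [Finset.mul_sum]
      exact Finset.sum_congr rfl fun n _ => by rw [pow_succ', mul_assoc]
    rw [← Finset.mul_sum, h2]
    linear_combination hpow - h3

/-- The `b` distinct small roots exhaust the zeros of a monic polynomial of degree `b`. -/
theorem smallPoly_eq_prod {W : Fin b → FracSeries K} (hW : Function.Injective W)
    (h0 : ∀ i, W i ∈ integerSeries (AlgebraicClosure K))
    (hroot : ∀ i, HahnSeries.single 1 1 * (stepPoly S ω b).eval₂ constToSeries (W i) = W i ^ b) :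
    smallPoly S ω b = ∏ i, (X - C (W i)) := by
  have hroots : Finset.univ.val.map W = (smallPoly S ω b).roots := by
    refine Multiset.eq_of_le_of_card_le ?_ ?_
    · rw [Multiset.le_iff_subset (Finset.univ.nodup.map hW)]
      intro V hV
      obtain ⟨i, -, rfl⟩ := Multiset.mem_map.1 hV
      rw [mem_roots smallPoly_monic.ne_zero]
      exact eval_smallPoly (h0 i) (hroot i)
    · refine (card_roots' _).trans ?_
      rw [natDegree_smallPoly]
      simp
  have h1 := prod_multiset_X_sub_C_of_monic_of_roots_card_eq (p := smallPoly S ω b)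
    smallPoly_monic (by rw [← hroots, natDegree_smallPoly]; simp)
  rw [← h1, ← hroots, Multiset.map_map]
  rfl

theorem excursionSeries_eq :
    excursionSeries S ω = PowerSeries.mk fun n => meanderWeight S ω n 0 := by
  classical
  exact congrArg PowerSeries.mk (funext fun n => Finset.sum_congr
    (Finset.ext fun s => by simp [excursions, IsExcursion]) fun _ _ => rfl)

/-- The generating function of excursions, in terms of the small roots of the kernel. -/
theorem prod_small_roots (hmem : -(b : ℤ) ∈ S) (hb : ∀ s ∈ S, -(b : ℤ) ≤ s) (hb0 : 0 < b)
    {W : Fin b → FracSeries K} (hW : Function.Injective W) (h0 : ∀ i, W i ∈ integerSeries (AlgebraicClosure K))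
    (hroot : ∀ i, HahnSeries.single 1 1 * (stepPoly S ω b).eval₂ constToSeries (W i) = W i ^ b) :
    ∏ i, W i = (-1) ^ (b + 1) * HahnSeries.single 1 1 * constToSeries (ω (-b)) *
      powerToSeries K (excursionSeries S ω) := by
  -- Comparing constant terms is Vieta's formula for the product.
  have h1 := congrArg (eval 0) (smallPoly_eq_prod hW h0 hroot)
  have h2 : remSeries S ω b 0 = PowerSeries.C (ω (-b)) * excursionSeries S ω := by
    ext n
    rw [remSeries, PowerSeries.coeff_mk, meanderRem_coeff_zero hmem hb hb0, PowerSeries.coeff_C_mul,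
      excursionSeries_eq, PowerSeries.coeff_mk]
  have h3 : powerToSeries K (PowerSeries.C (ω (-b))) = constToSeries (ω (-b)) := by
    simp [powerToSeries, constToSeries]
  rw [smallPoly, eval_sub, eval_finsetSum, eval_X_pow, zero_pow hb0.ne',
    Finset.sum_eq_single_of_mem 0 (Finset.mem_range.2 hb0) (by intro k _ hk; simp [hk]),
    eval_prod] at h1
  simp only [eval_mul, eval_C, pow_zero, mul_one, eval_sub, eval_X, zero_sub, h2,
    map_mul, h3, Finset.prod_neg, Finset.card_univ, Fintype.card_fin] at h1
  have h4 : ((-1) ^ b * (-1) ^ b : FracSeries K) = 1 := by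
    rw [← mul_pow]; simp
  rw [pow_succ]
  linear_combination -(-1) ^ b * h1 - (∏ i, W i) * h4

end Product

/-! ### Sign vectors and signed permutations -/

section SignedPow

variable {L : Type*} [Field L] {a : ℕ}

/-- The family of the `U i` and their inverses. -/
def signedPow (U : Fin a → L) (x : Fin a × ℤˣ) : L := U x.1 ^ (x.2 : ℤ)

/-- The multiset of the `U i ^ ε i`. -/
def signedFamily (U : Fin a → L) (ε : Fin a → ℤˣ) : Multiset L :=
  Finset.univ.val.map fun i => signedPow U (i, ε i)

theorem barQ_eq_prod_signedFamily (U : Fin a → L) :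
    barQ U = ((Finset.univ.val.map (signedFamily U)).map fun I => 1 - X * C I.prod).prod := by
  rw [Multiset.map_map]
  rfl

theorem barQ_map {M : Type*} [Field M] (f : L →+* M) (U : Fin a → L) :
    (barQ U).map f = barQ fun i => f (U i) := by
  simp [barQ, Polynomial.map_prod]

theorem bigQ_map {M : Type*} [Field M] (f : L →+* M) (R : Multiset L) (n : ℕ) :
    (bigQ R n).map f = bigQ (R.map f) n := by
  rw [bigQ, bigQ, Multiset.powersetCard_map, Polynomial.map_multiset_prod, Multiset.map_map,
    Multiset.map_map]
  refine congrArg Multiset.prod (Multiset.map_congr rfl fun I _ => ?_)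
  rw [Function.comp_apply, Function.comp_apply, Polynomial.map_sub, Polynomial.map_one,
    Polynomial.map_mul, map_X, map_C, map_multiset_prod]

/-- A signed permutation of the `U i` induces a bijection on sign vectors: multiply by `δ`, then
transport along `π`. The factors are merely reordered. -/
theorem barQ_signed_perm (U : Fin a → L) (π : Equiv.Perm (Fin a)) (δ : Fin a → ℤˣ) :
    barQ (fun i => signedPow U (π i, δ i)) = barQ U := by
  refine Fintype.prod_equiv ((Equiv.mulLeft δ).trans (Equiv.arrowCongr π (Equiv.refl _))) _ _
    fun ε => ?_
  congr 3
  refine Fintype.prod_equiv π _ _ fun i => ?_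
  simp [signedPow, zpow_mul]

variable {U : Fin a → L}

theorem signedFamily_injective (hU : Function.Injective (signedPow U)) :
    Function.Injective (signedFamily U) := by
  intro ε ε' h
  funext i
  have h1 : signedPow U (i, ε i) ∈ signedFamily U ε' := h ▸ Multiset.mem_map_of_mem _ (Finset.mem_univ i)
  obtain ⟨j, -, hj⟩ := Multiset.mem_map.1 h1
  have h2 := hU hj
  rw [Prod.mk.injEq] at h2
  obtain ⟨rfl, h2⟩ := h2
  exact h2.symm

theorem signedFamily_mem_powersetCard (hU : Function.Injective (signedPow U)) (ε : Fin a → ℤˣ) :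
    signedFamily U ε ∈ Multiset.powersetCard a (Finset.univ.val.map (signedPow U)) := by
  rw [Multiset.mem_powersetCard]
  refine ⟨?_, by simp [signedFamily]⟩
  rw [signedFamily, Multiset.le_iff_subset]
  · intro V hV
    obtain ⟨i, -, rfl⟩ := Multiset.mem_map.1 hV
    exact Multiset.mem_map_of_mem _ (Finset.mem_univ _)
  · exact Finset.univ.nodup.map fun i j hij => congrArg Prod.fst (hU hij)

theorem signedFamilies_le (hU : Function.Injective (signedPow U)) :
    Finset.univ.val.map (signedFamily U) ≤
      Multiset.powersetCard a (Finset.univ.val.map (signedPow U)) := by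
  rw [Multiset.le_iff_subset (Finset.univ.nodup.map (signedFamily_injective hU))]
  intro I hI
  obtain ⟨ε, -, rfl⟩ := Multiset.mem_map.1 hI
  exact signedFamily_mem_powersetCard hU ε

/-- Distinct sign vectors select distinct `a`-element sub-families, so the factors of `barQ` form a
sub-multiset of those of `bigQ`. -/
theorem barQ_dvd_bigQ (hU : Function.Injective (signedPow U)) :
    barQ U ∣ bigQ (Finset.univ.val.map (signedPow U)) a := by
  rw [barQ_eq_prod_signedFamily]
  exact Multiset.prod_dvd_prod_of_le (Multiset.map_le_map (signedFamilies_le hU))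

end SignedPow

/-! ### Galois descent of the coefficients -/

section Descent

variable {k E : Type*} [Field k] [Field E] [Algebra k E]

theorem exists_map_eq_of_forall_galois [FiniteDimensional k E] [IsGalois k E] {q : E[X]}
    (h : ∀ σ : E ≃ₐ[k] E, q.map (σ : E →+* E) = q) : ∃ r : k[X], r.map (algebraMap k E) = q := by
  rw [← mem_lifts, lifts_iff_coeff_lifts]
  intro n
  have h1 : q.coeff n ∈ (⊥ : IntermediateField k E) := by
    rw [IsGalois.mem_bot_iff_fixed]
    intro σ
    have := congrArg (fun p => p.coeff n) (h σ)
    simpa using this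
  exact IntermediateField.mem_bot.1 h1

theorem roots_map_galois {p : k[X]} (hp : (p.map (algebraMap k E)).Splits) (σ : E ≃ₐ[k] E) :
    (p.map (algebraMap k E)).roots.map σ = (p.map (algebraMap k E)).roots := by
  have h1 := hp.roots_map (σ : E →+* E)
  rw [Polynomial.map_map] at h1
  have h2 : (σ : E →+* E).comp (algebraMap k E) = algebraMap k E := σ.toAlgHom.comp_algebraMap
  rw [h2] at h1
  exact h1.symm

theorem barQ_galois {a : ℕ} {p : k[X]} (hp : (p.map (algebraMap k E)).Splits) {U : Fin a → E}
    (hU : Function.Injective (signedPow U))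
    (hroots : (p.map (algebraMap k E)).roots = Finset.univ.val.map (signedPow U)) (σ : E ≃ₐ[k] E) :
    (barQ U).map (σ : E →+* E) = barQ U := by
  have h1 : ∀ i, ∃ x, signedPow U x = σ (U i) := by
    intro i
    have h2 : σ (U i) ∈ (p.map (algebraMap k E)).roots := by
      rw [← roots_map_galois hp σ]
      refine Multiset.mem_map_of_mem _ ?_
      rw [hroots]
      exact Multiset.mem_map.2 ⟨(i, 1), Finset.mem_univ _, by simp [signedPow]⟩
    rw [hroots] at h2
    obtain ⟨x, -, hx⟩ := Multiset.mem_map.1 h2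
    exact ⟨x, hx⟩
  choose x hx using h1
  -- If `σ (U i)` and `σ (U j)` are signed powers of the same `U k`, then raising each to its own
  -- sign gives `U k` in both cases; injectivity of `σ` forces `i = j`.
  have hinj : Function.Injective fun i => (x i).1 := by
    intro i j hij
    dsimp only at hij
    have h3 : signedPow U (i, (x i).2) = signedPow U (j, (x j).2) := by
      apply σ.injective
      rw [signedPow, signedPow, map_zpow₀, map_zpow₀, ← hx, ← hx, signedPow, signedPow, hij,
        ← zpow_mul, ← zpow_mul, ← Units.val_mul, ← Units.val_mul, Int.units_mul_self,
        Int.units_mul_self]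
    exact congrArg Prod.fst (hU h3)
  rw [barQ_map, ← barQ_signed_perm U (Equiv.ofBijective _ (Finite.injective_iff_bijective.1 hinj))
    (fun i => (x i).2)]
  congr 1
  funext i
  exact (hx i).symm

variable {L : Type*} [Field L] [Algebra k L] [CharZero k]

theorem exists_map_eq_bigQ_barQ {a : ℕ} {p : k[X]} (hp : (p.map (algebraMap k L)).Splits)
    (hp0 : p ≠ 0) {U : Fin a → L} (hU : Function.Injective (signedPow U))
    (hroots : (p.map (algebraMap k L)).roots = Finset.univ.val.map (signedPow U)) :
    ∃ Q Qbar : k[X], Q.map (algebraMap k L) = bigQ (p.map (algebraMap k L)).roots a ∧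
      Qbar.map (algebraMap k L) = barQ U ∧ Qbar ∣ Q := by
  -- The large field `L` need not be Galois over `k`, so the argument runs in the splitting field
  -- generated by the roots; separability comes from characteristic zero.
  let M := IntermediateField.adjoin k (p.rootSet L)
  have : IsSplittingField k M p := IntermediateField.adjoin_rootSet_isSplittingField hp
  have : FiniteDimensional k M := IsSplittingField.finiteDimensional M p
  have : Normal k M := Normal.of_isSplittingField p
  have : IsGalois k M := ⟨⟩
  have hpM : (p.map (algebraMap k M)).Splits := IsSplittingField.splits M p
  have hmem : ∀ i, U i ∈ M := by
    intro i
    refine IntermediateField.subset_adjoin _ _ ?_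
    rw [mem_rootSet_of_ne hp0, ← eval_map_algebraMap, ← IsRoot.def,
      ← mem_roots ((Polynomial.map_ne_zero_iff (algebraMap k L).injective).2 hp0), hroots]
    exact Multiset.mem_map.2 ⟨(i, 1), Finset.mem_univ _, by simp [signedPow]⟩
  let V : Fin a → M := fun i => ⟨U i, hmem i⟩
  have hval : ∀ x, algebraMap M L (signedPow V x) = signedPow U x := by
    intro x
    rw [signedPow, map_zpow₀]
    rfl
  have hV : Function.Injective (signedPow V) := by
    intro x y hxy
    exact hU (by rw [← hval, ← hval, hxy])
  have htower : (algebraMap M L).comp (algebraMap k M) = algebraMap k L :=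
    (IsScalarTower.algebraMap_eq k M L).symm
  have hrM : (p.map (algebraMap k L)).roots =
      (p.map (algebraMap k M)).roots.map (algebraMap M L) := by
    rw [← hpM.roots_map, Polynomial.map_map, htower]
  have hrootsV : (p.map (algebraMap k M)).roots = Finset.univ.val.map (signedPow V) := by
    apply Multiset.map_injective (algebraMap M L).injective
    rw [← hrM, hroots, Multiset.map_map]
    exact Multiset.map_congr rfl fun x _ => (hval x).symm
  obtain ⟨Q, hQ⟩ := exists_map_eq_of_forall_galois (k := k)
    (q := bigQ (p.map (algebraMap k M)).roots a) fun σ => by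
      rw [bigQ_map]
      exact congrArg (fun R => bigQ R a) (roots_map_galois hpM σ)
  obtain ⟨Qbar, hQbar⟩ := exists_map_eq_of_forall_galois (k := k) (q := barQ V)
    (barQ_galois hpM hV hrootsV)
  have hQ' : Q.map (algebraMap k L) = bigQ (p.map (algebraMap k L)).roots a := by
    rw [← htower, ← Polynomial.map_map, hQ, bigQ_map, htower, hrM]
  have hQbar' : Qbar.map (algebraMap k L) = barQ U := by
    rw [← htower, ← Polynomial.map_map, hQbar, barQ_map]
    rfl
  refine ⟨Q, Qbar, hQ', hQbar', ?_⟩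
  rw [← Polynomial.map_dvd_map' (algebraMap k L), hQ', hQbar', hroots]
  exact barQ_dvd_bigQ hU

end Descent

/-! ### From coefficients in `K(t)` to coefficients in `K[t]` -/

section Integrality

theorem coeff_prod_one_sub_mem {L : Type*} [CommRing L] (A : Subring L) {M : Multiset L}
    (h : ∀ m ∈ M, m ∈ A) (n : ℕ) : ((M.map fun m => 1 - X * C m).prod).coeff n ∈ A := by
  have h1 : (M.map fun m => 1 - X * C m).prod ∈ lifts A.subtype := by
    refine Subsemiring.multiset_prod_mem _ _ fun q hq => ?_
    obtain ⟨m, hm, rfl⟩ := Multiset.mem_map.1 hq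
    exact (mem_lifts _).2 ⟨1 - X * C ⟨m, h m hm⟩, by simp⟩
  rw [lifts_iff_coeff_lifts] at h1
  obtain ⟨x, hx⟩ := h1 n
  rw [← hx]
  exact x.2

theorem coeff_prod_one_sub_mul_pow {L : Type*} [CommRing L] (M : Multiset L) (c : L) (n : ℕ) :
    ((M.map fun m => 1 - X * C m).prod).coeff n * c ^ n =
      (((M.map fun m => c * m).map fun m => 1 - X * C m).prod).coeff n := by
  rw [← comp_C_mul_X_coeff, multiset_prod_comp, Multiset.map_map, Multiset.map_map]
  congr 2
  refine Multiset.map_congr rfl fun m _ => ?_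
  simp
  ring

/-- The elements integral over a ring homomorphism form a subring. -/
def integralElems {R L : Type*} [CommRing R] [CommRing L] (φ : R →+* L) : Subring L where
  carrier := {x | φ.IsIntegralElem x}
  mul_mem' hx hy := RingHom.IsIntegralElem.mul φ hx hy
  one_mem' := φ.isIntegralElem_one
  add_mem' hx hy := RingHom.IsIntegralElem.add φ hx hy
  zero_mem' := φ.isIntegralElem_zero
  neg_mem' hx := RingHom.IsIntegralElem.neg φ hx

theorem mem_integralElems {R L : Type*} [CommRing R] [CommRing L] {φ : R →+* L} {x : L} :
    x ∈ integralElems φ ↔ φ.IsIntegralElem x := Set.mem_ofPred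

theorem exists_algebraMap_eq_of_isIntegralElem {R k L : Type*} [CommRing R] [IsDomain R]
    [IsIntegrallyClosed R] [Field k] [Algebra R k] [IsFractionRing R k] [Field L] {φ : R →+* L}
    {ψ : k →+* L} (h : ψ.comp (algebraMap R k) = φ) {x : k} (hx : φ.IsIntegralElem (ψ x)) :
    ∃ r, algebraMap R k r = x := by
  obtain ⟨p, hp, hpx⟩ := hx
  refine IsIntegrallyClosed.isIntegral_iff.1 ⟨p, hp, ψ.injective ?_⟩
  rw [hom_eval₂, h, hpx, map_zero]

variable {K : Type*} [Field K]

theorem ratToSeries_comp_algebraMap :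
    (ratToSeries K).comp (algebraMap K[X] (RatFunc K)) = polyToSeries K := by
  refine RingHom.ext fun p => ?_
  rw [RingHom.comp_apply, ratToSeries, IsFractionRing.lift_algebraMap]

theorem X_pow_dvd_of_eq_mul {p : K[X]} {n : ℕ} {y : FracSeries K}
    (hy : y ∈ integerSeries (AlgebraicClosure K))
    (h : polyToSeries K p = HahnSeries.single 1 1 ^ n * y) : X ^ n ∣ p := by
  rw [X_pow_dvd_iff]
  intro j hj
  have h1 : ((n : ℚ) : WithTop ℚ) ≤ (polyToSeries K p).orderTop := by
    rw [h, HahnSeries.single_pow, HahnSeries.orderTop_mul, one_pow,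
      HahnSeries.orderTop_single one_ne_zero, nsmul_eq_mul, mul_one]
    exact le_add_of_nonneg_right (mem_integerSeries.1 hy)
  have h2 : (polyToSeries K p).coeff (j : ℚ) = 0 :=
    HahnSeries.coeff_eq_zero_of_lt_orderTop (lt_of_lt_of_le (by exact_mod_cast hj) h1)
  rw [polyToSeries, RingHom.comp_apply, RingHom.comp_apply, HahnSeries.ofPowerSeries_apply_coeff]
    at h2
  simpa using h2

/-- A product `∏ (1 - z * m)` with coefficients in `K(t)` becomes a polynomial in `t` and `z` after
the substitution `z ↦ t * z`, if every `t * m` has no negative exponents and every `t ^ (e + 1) * m`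
is integral over `K[t]`. -/
theorem exists_map_eq_comp_of_integral {q : (RatFunc K)[X]} {M : Multiset (FracSeries K)}
    (hq : q.map (ratToSeries K) = (M.map fun m => 1 - X * C m).prod) (e : ℕ)
    (hint : ∀ m ∈ M, HahnSeries.single 1 1 ^ (e + 1) * m ∈ integralElems (polyToSeries K))
    (hord : ∀ m ∈ M, HahnSeries.single 1 1 * m ∈ integerSeries (AlgebraicClosure K)) (c : K[X])
    (hc : X ∣ c) :
    ∃ D : K[X][X], D.map (polyToSeries K) =
      ((M.map fun m => 1 - X * C m).prod).comp (C (polyToSeries K c) * X) := by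
  obtain ⟨d, rfl⟩ := hc
  rw [← mem_lifts, lifts_iff_coeff_lifts]
  intro n
  set T : FracSeries K := HahnSeries.single 1 1 with hT
  have hT0 : T ≠ 0 := HahnSeries.single_ne_zero one_ne_zero
  set P := (M.map fun m => 1 - X * C m).prod with hP
  have hX : ratToSeries K (algebraMap K[X] (RatFunc K) X) = T := by
    rw [← RingHom.comp_apply, ratToSeries_comp_algebraMap, polyToSeries_X]
  have h1 : P.coeff n * (T ^ (e + 1)) ^ n ∈ integralElems (polyToSeries K) := by
    rw [hP, coeff_prod_one_sub_mul_pow]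
    refine coeff_prod_one_sub_mem _ (fun m hm => ?_) n
    obtain ⟨m, hm', rfl⟩ := Multiset.mem_map.1 hm
    exact hint m hm'
  have h2 : P.coeff n * T ^ n ∈ integerSeries (AlgebraicClosure K) := by
    rw [hP, coeff_prod_one_sub_mul_pow]
    refine coeff_prod_one_sub_mem _ (fun m hm => ?_) n
    obtain ⟨m, hm', rfl⟩ := Multiset.mem_map.1 hm
    exact hord m hm'
  have h3 : ratToSeries K (q.coeff n * (algebraMap K[X] (RatFunc K) X ^ (e + 1)) ^ n) =
      P.coeff n * (T ^ (e + 1)) ^ n := by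
    rw [map_mul, map_pow, map_pow, hX, ← hq, coeff_map]
  rw [← h3] at h1
  -- Integrality only shows that the coefficient times `t ^ ((e + 1) * n)` is a polynomial, since
  -- `K[t]` is integrally closed.
  obtain ⟨r, hr⟩ := exists_algebraMap_eq_of_isIntegralElem ratToSeries_comp_algebraMap
    (mem_integralElems.1 h1)
  have h4 : polyToSeries K r = T ^ (e * n) * (P.coeff n * T ^ n) := by
    rw [← ratToSeries_comp_algebraMap, RingHom.comp_apply, hr, h3]
    ring
  -- The bound on orders makes the surplus power `t ^ (e * n)` divide that polynomial; cancelling it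
  -- leaves exactly the factor `t ^ n` supplied by the substitution.
  obtain ⟨s, rfl⟩ := X_pow_dvd_of_eq_mul h2 h4
  rw [map_mul, map_pow, polyToSeries_X] at h4
  have h5 := mul_left_cancel₀ (pow_ne_zero _ hT0) h4
  refine ⟨d ^ n * s, ?_⟩
  rw [comp_C_mul_X_coeff, map_mul, map_pow, h5, map_mul, polyToSeries_X]
  ring

end Integrality

/-! ### The factors for the kernel, and divisibility -/

section Conclusion

theorem natDegree_barQ_comp {L : Type*} [Field L] {a : ℕ} {U : Fin a → L} (hU : ∀ i, U i ≠ 0)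
    {c : L} (hc : c ≠ 0) : ((barQ U).comp (C c * X)).natDegree = 2 ^ a := by
  have h1 : ∀ m : L, m ≠ 0 → (1 - X * C m : L[X]).natDegree = 1 := by
    intro m hm
    rw [← natDegree_neg, neg_sub, mul_comm, ← C_1, natDegree_sub_C, natDegree_C_mul_X _ hm]
  have h2 : ∀ ε : Fin a → ℤˣ, (∏ i, U i ^ (ε i : ℤ)) ≠ 0 := fun ε =>
    Finset.prod_ne_zero_iff.2 fun i _ => zpow_ne_zero _ (hU i)
  rw [natDegree_comp, natDegree_C_mul_X _ hc, mul_one, barQ, natDegree_prod]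
  · rw [Finset.sum_congr rfl fun ε _ => h1 _ (h2 ε)]
    simp
  · intro ε _ h
    have := h1 _ (h2 ε)
    rw [h, natDegree_zero] at this
    exact zero_ne_one this

theorem eval_zero_barQ {L : Type*} [Field L] {a : ℕ} (U : Fin a → L) : (barQ U).eval 0 = 1 := by
  simp [barQ, eval_prod]

theorem eval_prod_barQ {L : Type*} [Field L] {a : ℕ} {U : Fin a → L} (hU : ∀ i, U i ≠ 0) :
    (barQ U).eval (∏ i, U i) = 0 := by
  rw [barQ, eval_prod]
  -- The constant vector `-1` gives the factor `1 - z / ∏ U i`.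
  refine Finset.prod_eq_zero (Finset.mem_univ (-1)) ?_
  simp [inv_mul_cancel₀ (Finset.prod_ne_zero_iff.2 fun i _ => hU i)]

variable {K : Type*} [Field K] {S : Finset ℤ} {ω : ℤ → K} {a : ℕ}

theorem coeff_kernel_two_mul (ha : IsGreatest (S : Set ℤ) (a : ℤ)) (hb : ∀ s ∈ S, -(a : ℤ) ≤ s)
    (ha_pos : 0 < a) : (kernel S ω a).coeff (2 * a) = -(X * C (ω a)) := by
  rw [kernel, coeff_sub, coeff_X_pow, if_neg (by omega), coeff_C_mul, finsetSum_coeff,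
    Finset.sum_eq_single_of_mem (a : ℤ) ha.1, zero_sub]
  · rw [coeff_C_mul_X_pow, if_pos (by omega)]
  · intro s hs hne
    have h1 := ha.2 hs
    have h2 := hb s hs
    rw [coeff_C_mul_X_pow, if_neg (by omega)]

theorem natDegree_kernel (ha : IsGreatest (S : Set ℤ) (a : ℤ)) (hb : ∀ s ∈ S, -(a : ℤ) ≤ s)
    (ha_pos : 0 < a) (hωa : ω a ≠ 0) : (kernel S ω a).natDegree = 2 * a := by
  refine natDegree_eq_of_le_of_coeff_ne_zero (natDegree_kernel_le fun s hs => ha.2 hs) ?_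
  rw [coeff_kernel_two_mul ha hb ha_pos, neg_ne_zero]
  exact mul_ne_zero X_ne_zero (C_ne_zero.2 hωa)

theorem kernel_ne_zero (ha : IsGreatest (S : Set ℤ) (a : ℤ)) (hb : ∀ s ∈ S, -(a : ℤ) ≤ s)
    (ha_pos : 0 < a) (hωa : ω a ≠ 0) : kernel S ω a ≠ 0 :=
  ne_zero_of_natDegree_gt (n := 0) (by rw [natDegree_kernel ha hb ha_pos hωa]; omega)

/-- A root times the leading coefficient of its polynomial is integral, and here the leading
coefficient is `-t * ω_a`, with `ω_a` a unit. -/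
theorem single_mul_mem_integralElems (ha : IsGreatest (S : Set ℤ) (a : ℤ))
    (hb : ∀ s ∈ S, -(a : ℤ) ≤ s) (ha_pos : 0 < a) (hωa : ω a ≠ 0) {V : FracSeries K}
    (hV : V ∈ kernelRoots S ω a) :
    HahnSeries.single 1 1 * V ∈ integralElems (polyToSeries K) := by
  have h1 := RingHom.isIntegralElem_leadingCoeff_mul (polyToSeries K) (kernel S ω a) V (by
    rw [← eval_map]
    exact (mem_roots'.1 hV).2)
  rw [leadingCoeff, natDegree_kernel ha hb ha_pos hωa, coeff_kernel_two_mul ha hb ha_pos] at h1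
  have h2 : (HahnSeries.single 1 1 * V : FracSeries K) = polyToSeries K (C (-(ω a)⁻¹)) *
      (polyToSeries K (-(X * C (ω a))) * V) := by
    rw [← mul_assoc, ← map_mul, ← polyToSeries_X]
    congr 2
    have h3 : (C (ω a)⁻¹ * C (ω a) : K[X]) = 1 := by
      rw [← C_mul, inv_mul_cancel₀ hωa, map_one]
    rw [map_neg]
    linear_combination -X * h3
  rw [h2]
  exact Subring.mul_mem _ (mem_integralElems.2 (RingHom.isIntegralElem_map _))
    (mem_integralElems.2 h1)

theorem scale_ne_zero (hωa : ω a ≠ 0) : scale ω a ≠ 0 := by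
  simp [scale, hωa]

theorem X_dvd_scale : X ∣ scale ω a := ⟨(-1) ^ (a + 1) * C (ω a), by rw [scale]; ring⟩

theorem polyToSeries_scale : polyToSeries K (scale ω a) =
    (-1) ^ (a + 1) * HahnSeries.single 1 1 * constToSeries (ω a) := by
  rw [scale, map_mul, map_mul, polyToSeries_X, polyToSeries_C, map_pow, map_neg, map_one]
  rfl

section Roots

variable {U : Fin a → FracSeries K}

theorem ne_zero_of_orderTop (hord : ∀ i, (U i).orderTop = ((a : ℚ)⁻¹ : ℚ)) (i : Fin a) :
    U i ≠ 0 := fun h => by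
  have := hord i
  rw [h, HahnSeries.orderTop_zero] at this
  exact WithTop.top_ne_coe this

theorem signedPow_injective (hord : ∀ i, (U i).orderTop = ((a : ℚ)⁻¹ : ℚ))
    (hU : Function.Injective U) : Function.Injective (signedPow U) := by
  have h1 : ∀ i j, U i ≠ (U j)⁻¹ := by
    intro i j h
    have h2 := orderTop_inv_neg (hord j)
    rw [← h, hord] at h2
    have h3 : (a : ℚ)⁻¹ = -(a : ℚ)⁻¹ := by exact_mod_cast h2
    have h4 : (0 : ℚ) < a := Nat.cast_pos.2 i.pos
    have : (0 : ℚ) < (a : ℚ)⁻¹ := by positivity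
    linarith
  rintro ⟨i, δ⟩ ⟨j, η⟩ h
  rcases Int.units_eq_one_or δ with rfl | rfl <;> rcases Int.units_eq_one_or η with rfl | rfl <;>
    simp [signedPow] at h
  · rw [hU h]
  · exact absurd h (h1 i j)
  · exact absurd h.symm (h1 j i)
  · rw [hU h]

theorem single_mul_signedPow_mem (hord : ∀ i, (U i).orderTop = ((a : ℚ)⁻¹ : ℚ))
    (x : Fin a × ℤˣ) :
    HahnSeries.single (a : ℚ)⁻¹ 1 * signedPow U x ∈ integerSeries (AlgebraicClosure K) := by
  obtain ⟨i, δ⟩ := x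
  rw [mem_integerSeries, HahnSeries.orderTop_mul, HahnSeries.orderTop_single one_ne_zero]
  rcases Int.units_eq_one_or δ with rfl | rfl
  · simp only [signedPow, Units.val_one, zpow_one, hord]
    exact_mod_cast (by positivity : (0 : ℚ) ≤ (a : ℚ)⁻¹ + (a : ℚ)⁻¹)
  · simp only [signedPow, Units.val_neg, Units.val_one, zpow_neg, zpow_one,
      orderTop_inv_neg (hord i)]
    exact_mod_cast (by simp : (0 : ℚ) ≤ (a : ℚ)⁻¹ + -(a : ℚ)⁻¹)

end Roots

theorem prod_map_const_mul {L : Type*} [CommMonoid L] (c : L) (I : Multiset L) :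
    (I.map fun V => c * V).prod = c ^ I.card * I.prod := by
  rw [Multiset.prod_map_mul, Multiset.map_const', Multiset.prod_replicate, Multiset.map_id']

theorem exists_factors [CharZero K] (ha : IsGreatest (S : Set ℤ) (a : ℤ))
    (hb : ∀ s ∈ S, -(a : ℤ) ≤ s) (ha_pos : 0 < a) (hωa : ω a ≠ 0) (hS : ∀ s ∈ S, -s ∈ S)
    (hω : ∀ s ∈ S, ω (-s) = ω s) {U : Fin a → FracSeries K} (hU : Function.Injective U)
    (hord : ∀ i, (U i).orderTop = ((a : ℚ)⁻¹ : ℚ))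
    (hroot : ∀ i, HahnSeries.single 1 1 * stepSum S ω (U i) = 1) :
    ∃ (Q Qbar : (RatFunc K)[X]) (D Dbar : K[X][X]),
      Q.map (ratToSeries K) = bigQ (kernelRoots S ω a) a ∧
      Qbar.map (ratToSeries K) = barQ U ∧ Qbar ∣ Q ∧
      D.map (polyToSeries K) = (bigQ (kernelRoots S ω a) a).comp
        (C (polyToSeries K (scale ω a)) * X) ∧
      Dbar.map (polyToSeries K) = (barQ U).comp (C (polyToSeries K (scale ω a)) * X) := by
  have hker := kernel_ne_zero ha hb ha_pos hωa
  have hsp := signedPow_injective hord hU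
  have hroots0 := kernelRoots_eq (fun s hs => ha.2 hs) hb hker hS hω hU hord hroot
  have hroots : kernelRoots S ω a = Finset.univ.val.map (signedPow U) := by
    symm
    refine Multiset.eq_of_le_of_card_le ?_ ?_
    · rw [Multiset.le_iff_subset (Finset.univ.nodup.map hsp), hroots0]
      intro V hV
      obtain ⟨⟨i, δ⟩, -, rfl⟩ := Multiset.mem_map.1 hV
      rw [Multiset.mem_add]
      rcases Int.units_eq_one_or δ with rfl | rfl
      · exact Or.inl (Multiset.mem_map.2 ⟨i, Finset.mem_univ i, by simp [signedPow]⟩)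
      · exact Or.inr (Multiset.mem_map.2 ⟨i, Finset.mem_univ i, by simp [signedPow]⟩)
    · rw [hroots0]
      simp [mul_two]
  let _ : Algebra (RatFunc K) (FracSeries K) := (ratToSeries K).toAlgebra
  have hmapmap : ((kernel S ω a).map (algebraMap K[X] (RatFunc K))).map (ratToSeries K) =
      (kernel S ω a).map (polyToSeries K) := by
    rw [Polynomial.map_map, ratToSeries_comp_algebraMap]
  have hr : (((kernel S ω a).map (algebraMap K[X] (RatFunc K))).map
      (algebraMap (RatFunc K) (FracSeries K))).roots = kernelRoots S ω a :=
    congrArg roots hmapmap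
  have hsplit : (((kernel S ω a).map (algebraMap K[X] (RatFunc K))).map
      (algebraMap (RatFunc K) (FracSeries K))).Splits := by
    rw [splits_iff_card_roots, hr, natDegree_map,
      natDegree_map_eq_of_injective (IsFractionRing.injective K[X] (RatFunc K)),
      natDegree_kernel ha hb ha_pos hωa, hroots0]
    simp [two_mul]
  have hker0 : (kernel S ω a).map (algebraMap K[X] (RatFunc K)) ≠ 0 :=
    (Polynomial.map_ne_zero_iff (IsFractionRing.injective K[X] (RatFunc K))).2 hker
  obtain ⟨Q, Qbar, hQ, hQbar, hdvd⟩ := exists_map_eq_bigQ_barQ hsplit hker0 hsp (hr.trans hroots)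
  rw [hr] at hQ
  have hint : ∀ m ∈ (Multiset.powersetCard a (kernelRoots S ω a)).map Multiset.prod,
      HahnSeries.single 1 1 ^ (a - 1 + 1) * m ∈ integralElems (polyToSeries K) := by
    intro m hm
    obtain ⟨I, hI, rfl⟩ := Multiset.mem_map.1 hm
    rw [Multiset.mem_powersetCard] at hI
    rw [Nat.sub_add_cancel ha_pos, ← hI.2, ← prod_map_const_mul]
    refine Subring.multiset_prod_mem _ _ fun V hV => ?_
    obtain ⟨V, hV', rfl⟩ := Multiset.mem_map.1 hV
    exact single_mul_mem_integralElems ha hb ha_pos hωa (Multiset.mem_of_le hI.1 hV')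
  have hval : ∀ m ∈ (Multiset.powersetCard a (kernelRoots S ω a)).map Multiset.prod,
      HahnSeries.single 1 1 * m ∈ integerSeries (AlgebraicClosure K) := by
    intro m hm
    obtain ⟨I, hI, rfl⟩ := Multiset.mem_map.1 hm
    rw [Multiset.mem_powersetCard] at hI
    -- One factor `t ^ (1/a)` is given to each of the `a` roots; since every root has order at least
    -- `-1/a`, a single `t` suffices for the whole product.
    have h1 : (HahnSeries.single 1 1 : FracSeries K) =
        HahnSeries.single (a : ℚ)⁻¹ 1 ^ I.card := by
      rw [hI.2, HahnSeries.single_pow, one_pow, nsmul_eq_mul,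
        mul_inv_cancel₀ (Nat.cast_ne_zero.2 ha_pos.ne')]
    rw [h1, ← prod_map_const_mul]
    refine Subring.multiset_prod_mem _ _ fun V hV => ?_
    obtain ⟨V, hV', rfl⟩ := Multiset.mem_map.1 hV
    have h2 := Multiset.mem_of_le hI.1 hV'
    rw [hroots] at h2
    obtain ⟨x, -, rfl⟩ := Multiset.mem_map.1 h2
    exact single_mul_signedPow_mem hord x
  have hbig : bigQ (kernelRoots S ω a) a =
      (((Multiset.powersetCard a (kernelRoots S ω a)).map Multiset.prod).map
        fun m => 1 - X * C m).prod := by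
    rw [Multiset.map_map]
    rfl
  have hbar : barQ U = (((Finset.univ.val.map (signedFamily U)).map Multiset.prod).map
        fun m => 1 - X * C m).prod := by
    rw [Multiset.map_map, barQ_eq_prod_signedFamily]
    rfl
  have hle : ∀ m ∈ (Finset.univ.val.map (signedFamily U)).map Multiset.prod,
      m ∈ (Multiset.powersetCard a (kernelRoots S ω a)).map Multiset.prod := by
    rw [hroots]
    exact fun m hm => Multiset.mem_of_le (Multiset.map_le_map (signedFamilies_le hsp)) hm
  -- The choice `e = a - 1` reflects that integrality of a product of `a` roots costs `t ^ a`, while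
  -- its order costs only `t`.
  obtain ⟨D, hD⟩ := exists_map_eq_comp_of_integral (hQ.trans hbig) (a - 1) hint hval (scale ω a)
    X_dvd_scale
  obtain ⟨Dbar, hDbar⟩ := exists_map_eq_comp_of_integral (hQbar.trans hbar) (a - 1)
    (fun m hm => hint m (hle m hm)) (fun m hm => hval m (hle m hm)) (scale ω a) X_dvd_scale
  exact ⟨Q, Qbar, D, Dbar, hQ, hQbar, hdvd, hbig ▸ hD, hbar ▸ hDbar⟩

theorem map_eq_comp_scale {q : (RatFunc K)[X]} {D : K[X][X]} {P : (FracSeries K)[X]} {c : K[X]}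
    (hq : q.map (ratToSeries K) = P)
    (hD : D.map (polyToSeries K) = P.comp (C (polyToSeries K c) * X)) :
    D.map (algebraMap K[X] (RatFunc K)) = q.comp (C (algebraMap K[X] (RatFunc K) c) * X) := by
  apply Polynomial.map_injective _ (ratToSeries K).injective
  rw [Polynomial.map_map, ratToSeries_comp_algebraMap, hD, Polynomial.map_comp, hq,
    Polynomial.map_mul, map_C, map_X, ← ratToSeries_comp_algebraMap, RingHom.comp_apply]

/-- The constant coefficient `1` makes `Dbar` primitive, so Gauss's lemma brings divisibility over
`K(t)` down to `K[t]`. -/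
theorem dvd_of_map_eq_comp {Q Qbar : (RatFunc K)[X]} {D Dbar : K[X][X]} {c : (RatFunc K)[X]}
    (hD : D.map (algebraMap K[X] (RatFunc K)) = Q.comp c)
    (hDbar : Dbar.map (algebraMap K[X] (RatFunc K)) = Qbar.comp c) (hdvd : Qbar ∣ Q)
    (h0 : Dbar.coeff 0 = 1) : Dbar ∣ D := by
  have hprim : Dbar.IsPrimitive := by
    intro r hr
    rw [C_dvd_iff_dvd_coeff] at hr
    exact isUnit_of_dvd_one (h0 ▸ hr 0)
  rw [hprim.dvd_iff_fraction_map_dvd_fraction_map (K := RatFunc K), hD, hDbar]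
  obtain ⟨q, rfl⟩ := hdvd
  exact ⟨q.comp c, mul_comp _ _ _⟩

theorem algebraMap_laurent_comp :
    (algebraMap (RatFunc K) (LaurentSeries K)).comp (algebraMap K[X] (RatFunc K)) =
      (HahnSeries.ofPowerSeries ℤ K).comp coeToPowerSeries.ringHom :=
  RingHom.ext fun p => (RatFunc.coe_coe p).symm

theorem aeval_map_laurent (D : K[X][X]) (x : PowerSeries K) :
    (D.map (algebraMap K[X] (RatFunc K))).aeval (HahnSeries.ofPowerSeries ℤ K x) =
      HahnSeries.ofPowerSeries ℤ K (D.eval₂ coeToPowerSeries.ringHom x) := by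
  rw [aeval_def, eval₂_map, algebraMap_laurent_comp, hom_eval₂]

end Conclusion

end Excursions

end

/-! ### The main theorem -/

theorem mainTheorem7 {K : Type*} [Field K] [CharZero K]
    (S : Finset ℤ) (ω : ℤ → K) (a b : ℕ)
    (ha : IsGreatest (S : Set ℤ) (a : ℤ)) (hb : IsLeast (S : Set ℤ) (-(b : ℤ)))
    (ha_pos : 0 < a) (hωa : ω a ≠ 0)
    (hS : ∀ s ∈ S, -s ∈ S) (hω : ∀ s ∈ S, ω (-s) = ω s) :
    a = b ∧
    -- all `a + b` roots are Puiseux series; `b` of them are small and `a` are large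
    (∀ V ∈ Excursions.kernelRoots S ω b, ∀ q ∈ V.support, ∃ m : ℤ, q = (m : ℚ) / (a : ℚ)) ∧
    Multiset.card (Excursions.smallRoots S ω b) = b ∧
    Multiset.card (Excursions.largeRoots S ω b) = a ∧
    -- the large roots are the inverses of the small roots
    Excursions.largeRoots S ω b = (Excursions.smallRoots S ω b).map (fun V => V⁻¹) ∧
    (∀ U : Fin a → Excursions.FracSeries K,
      Multiset.map U Finset.univ.val = Excursions.smallRoots S ω b →
      -- `Q` and `Q̄` have coefficients in `K(t)`, `Q̄` divides `Q`, and `Q̄` vanishes at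
      -- `(-1) ^ (a + 1) * t * ω_a * E`
      (∃ Q Qbar : (RatFunc K)[X],
        Q.map (Excursions.ratToSeries K)
          = Excursions.bigQ (Excursions.kernelRoots S ω b) a ∧
        Qbar.map (Excursions.ratToSeries K) = Excursions.barQ U ∧
        Qbar ∣ Q ∧
        Qbar.aeval (((Excursions.scale ω a : PowerSeries K) *
          Excursions.excursionSeries S ω : PowerSeries K) : LaurentSeries K) = 0) ∧
      -- after the substitution `z ↦ (-1) ^ (a + 1) * t * ω_a * z`, both are polynomials in `t`
      -- and `z`, divisibility holds in `K[t, z]`, and `E` itself is a zero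
      (∃ D Dbar : K[X][X],
        D.map (Excursions.polyToSeries K)
          = (Excursions.bigQ (Excursions.kernelRoots S ω b) a).comp
              (C (Excursions.polyToSeries K (Excursions.scale ω a)) * X) ∧
        Dbar.map (Excursions.polyToSeries K)
          = (Excursions.barQ U).comp
              (C (Excursions.polyToSeries K (Excursions.scale ω a)) * X) ∧
        Dbar ∣ D ∧
        Dbar.natDegree = 2 ^ a ∧
        Dbar.eval₂ Polynomial.coeToPowerSeries.ringHom (Excursions.excursionSeries S ω) = 0)) ∧
    -- `E` is algebraic over `K(t)`, of degree at most `2 ^ a`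
    IsAlgebraic (RatFunc K) (Excursions.excursionSeries S ω : LaurentSeries K) ∧
    (minpoly (RatFunc K) (Excursions.excursionSeries S ω : LaurentSeries K)).natDegree
      ≤ 2 ^ a := by
  classical
  have hab : a = b := by
    have h1 := hb.2 (hS _ ha.1)
    have h2 := ha.2 (by simpa using hS _ hb.1 : (b : ℤ) ∈ (S : Set ℤ))
    omega
  subst hab
  have hb' : ∀ s ∈ S, -(a : ℤ) ≤ s := fun s hs => hb.2 hs
  obtain ⟨W, hW, hord, hsupp, hsupp', hroot⟩ :=
    Excursions.exists_small_roots ha hb' ha_pos hωa hS hω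
  have hker : Excursions.kernel S ω a ≠ 0 :=
    Excursions.kernel_ne_zero ha hb' ha_pos hωa
  have hroots := Excursions.kernelRoots_eq (fun s hs => ha.2 hs) hb' hker hS hω hW hord hroot
  have hneg : ∀ i, (W i)⁻¹.orderTop < 0 := fun i => by
    rw [Excursions.orderTop_inv_neg (hord i)]
    have h1 : (0 : ℚ) < (a : ℚ)⁻¹ := inv_pos.2 (Nat.cast_pos.2 ha_pos)
    exact_mod_cast (by linarith : -(a : ℚ)⁻¹ < 0)
  obtain ⟨hsmall, hlarge⟩ := Excursions.smallRoots_eq hord hneg hroots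
  -- Any enumeration `U` of the small roots takes its values among the `W j` and is injective, so it
  -- inherits the orders and the root equation.
  have key : ∀ U : Fin a → Excursions.FracSeries K,
      Multiset.map U Finset.univ.val = Excursions.smallRoots S ω a →
      ∃ (Q Qbar : (RatFunc K)[X]) (D Dbar : K[X][X]),
        Q.map (Excursions.ratToSeries K)
          = Excursions.bigQ (Excursions.kernelRoots S ω a) a ∧
        Qbar.map (Excursions.ratToSeries K) = Excursions.barQ U ∧
        Qbar ∣ Q ∧
        Qbar.aeval (((Excursions.scale ω a : PowerSeries K) *
          Excursions.excursionSeries S ω : PowerSeries K) : LaurentSeries K) = 0 ∧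
        D.map (Excursions.polyToSeries K)
          = (Excursions.bigQ (Excursions.kernelRoots S ω a) a).comp
              (C (Excursions.polyToSeries K (Excursions.scale ω a)) * X) ∧
        Dbar.map (Excursions.polyToSeries K)
          = (Excursions.barQ U).comp
              (C (Excursions.polyToSeries K (Excursions.scale ω a)) * X) ∧
        Dbar ∣ D ∧
        Dbar.natDegree = 2 ^ a ∧
        Dbar.eval₂ Polynomial.coeToPowerSeries.ringHom (Excursions.excursionSeries S ω) = 0 := by
    intro U hU
    have hmem : ∀ i, ∃ j, W j = U i := by
      intro i
      have h1 : U i ∈ Excursions.smallRoots S ω a :=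
        hU ▸ Multiset.mem_map_of_mem U (Finset.mem_univ i)
      rw [hsmall] at h1
      obtain ⟨j, -, hj⟩ := Multiset.mem_map.1 h1
      exact ⟨j, hj⟩
    have hUinj : Function.Injective U := by
      have h1 : (Multiset.map U Finset.univ.val).Nodup := by
        rw [hU, hsmall]
        exact Finset.univ.nodup.map hW
      intro i j hij
      exact Multiset.inj_on_of_nodup_map h1 i (Finset.mem_univ i) j (Finset.mem_univ j) hij
    have hUord : ∀ i, (U i).orderTop = ((a : ℚ)⁻¹ : ℚ) := fun i => by
      obtain ⟨j, hj⟩ := hmem i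
      rw [← hj, hord]
    have hUroot : ∀ i, HahnSeries.single 1 1 * Excursions.stepSum S ω (U i) = 1 := fun i => by
      obtain ⟨j, hj⟩ := hmem i
      rw [← hj, hroot]
    have hU0 := Excursions.ne_zero_of_orderTop hUord
    have hUint : ∀ i, U i ∈ Excursions.integerSeries (AlgebraicClosure K) := fun i => by
      rw [Excursions.mem_integerSeries, hUord]
      exact_mod_cast (by positivity : (0 : ℚ) ≤ (a : ℚ)⁻¹)
    obtain ⟨Q, Qbar, D, Dbar, hQ, hQbar, hdvd, hD, hDbar⟩ :=
      Excursions.exists_factors ha hb' ha_pos hωa hS hω hUinj hUord hUroot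
    -- The kernel method produces the weight of the lowest step, `ω (-a)`; symmetry turns it into
    -- the `ω a` of `scale`.
    have hprod : Excursions.polyToSeries K (Excursions.scale ω a) *
        Excursions.powerToSeries K (Excursions.excursionSeries S ω) = ∏ i, U i := by
      rw [Excursions.prod_small_roots hb.1 hb' ha_pos hUinj hUint fun i => by
        rw [Excursions.eval₂_stepPoly hb' (hU0 i), mul_left_comm, hUroot, mul_one],
        Excursions.polyToSeries_scale, hω _ ha.1]
    have hzero : Dbar.eval₂ Polynomial.coeToPowerSeries.ringHom
        (Excursions.excursionSeries S ω) = 0 := by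
      apply Excursions.powerToSeries_injective
      have h1 : (Excursions.powerToSeries K).comp Polynomial.coeToPowerSeries.ringHom =
          Excursions.polyToSeries K := rfl
      rw [hom_eval₂, h1, ← eval_map, hDbar, eval_comp, eval_mul, eval_C, eval_X, hprod,
        Excursions.eval_prod_barQ hU0, map_zero]
    have hcoeff : Dbar.coeff 0 = 1 := by
      apply Excursions.polyToSeries_injective
      rw [← coeff_map, hDbar, coeff_zero_eq_eval_zero, eval_comp, eval_mul, eval_X, mul_zero,
        Excursions.eval_zero_barQ, map_one]
    have hDbarMap := Excursions.map_eq_comp_scale hQbar hDbar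
    refine ⟨Q, Qbar, D, Dbar, hQ, hQbar, hdvd, ?_, hD, hDbar,
      Excursions.dvd_of_map_eq_comp (Excursions.map_eq_comp_scale hQ hD) hDbarMap hdvd hcoeff, ?_,
      hzero⟩
    · have h1 := Excursions.aeval_map_laurent Dbar (Excursions.excursionSeries S ω)
      rw [hzero, map_zero, hDbarMap, aeval_comp, map_mul, aeval_C, aeval_X] at h1
      rw [← h1, map_mul]
      exact congrArg (fun x => Qbar.aeval (x * _)) (RatFunc.coe_coe (Excursions.scale ω a))
    · rw [← natDegree_map_eq_of_injective Excursions.polyToSeries_injective, hDbar,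
        Excursions.natDegree_barQ_comp hU0]
      exact (map_ne_zero_iff _ Excursions.polyToSeries_injective).2 (Excursions.scale_ne_zero hωa)
  refine ⟨rfl, ?_, ?_, ?_, ?_, ?_, ?_⟩
  · intro V hV
    rw [hroots, Multiset.mem_add, Multiset.mem_map, Multiset.mem_map] at hV
    rcases hV with ⟨i, -, rfl⟩ | ⟨i, -, rfl⟩
    · exact hsupp i
    · exact hsupp' i
  · rw [hsmall]; simp
  · rw [hlarge]; simp
  · rw [hlarge, hsmall, Multiset.map_map]
    rfl
  · intro U hU
    obtain ⟨Q, Qbar, D, Dbar, h1, h2, h3, h4, h5, h6, h7, h8, h9⟩ := key U hU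
    exact ⟨⟨Q, Qbar, h1, h2, h3, h4⟩, D, Dbar, h5, h6, h7, h8, h9⟩
  · obtain ⟨Q, Qbar, D, Dbar, h1, h2, h3, h4, h5, h6, h7, h8, h9⟩ := key W hsmall.symm
    have hinj := IsFractionRing.injective K[X] (RatFunc K)
    have hdeg := natDegree_map_eq_of_injective hinj Dbar
    -- The degree `2 ^ a` is positive, so the annihilating polynomial is not zero.
    have hne : Dbar.map (algebraMap K[X] (RatFunc K)) ≠ 0 := by
      intro h
      rw [h, natDegree_zero, h8] at hdeg
      exact absurd hdeg (by positivity : 0 < 2 ^ a).ne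
    have hz : (Dbar.map (algebraMap K[X] (RatFunc K))).aeval
        (Excursions.excursionSeries S ω : LaurentSeries K) = 0 := by
      rw [Excursions.aeval_map_laurent, h9, map_zero]
    refine ⟨⟨_, hne, hz⟩, ?_⟩
    rw [← h8, ← hdeg]
    exact natDegree_le_of_dvd (minpoly.dvd _ _ hz) hne
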